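/- **Model.** A tree network is a finite tree $T$ with $n$ unlabelled nodes in which the edges incident to each node $v$ carry distinct port numbers $0,\dots,\deg(v)-1$ at $v$. Write $\mathrm{seq}(a,b)$ for the sequence of all ports (outgoing port, then incoming port, for each edge) on the simple path from $a$ to $b$. The view $V(v,r)$ is the subtree induced by the nodes at distance at most $r$ from $v$, rooted at $v$, with all port numbers at these nodes and with the degrees of the nodes at distance exactly $r$, up to isomorphism. In a deterministic algorithm in the LOCAL model, what a node $v$ does after $r$ rounds (continue, or stop with an output) is a function of $r$, of $V(v,r)$ and of the advice, a binary string that is the same for all nodes and is chosen by an oracle knowing $T$; its size is its length. The algorithm solves leader election in $T$ in time $\tau$ if every node stops within $\tau$ rounds with an output $P(v)$, a finite sequence of integers, such that taking the members of $P(v)$ as successive outgoing ports from $v$ gives a simple path, and all these paths end at a common node. Let $\xi(T)$ be the minimum time in which leader election in $T$ is feasible if every node is given the map of $T$ (without its own position); $\xi(T)=\infty$ if it is never feasible. **Advice of OddElect.** Let $T$ have odd diameter $D=2h+1\ge 3$, and let $\{c_0,c_1\}$ be its central edge, the middle edge of all simple paths of length $D$. An endless path of $v$ is a simple path of length $D-2$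 from $v$ to a node that is not a leaf. The gateway $g_v$ is the node of $V(v,D-2)$ furthest from $v$ through which all endless paths of $v$ pass. $T$ is separated if for every node $v$ the path from $v$ to $g_v$ contains the central edge. If $T$ is separated, let $L_i$ be the lexicographically ordered list of the sequences $\mathrm{seq}(c_i,y)$ over all nodes $y$ for which the path from $c_i$ to $y$ does not contain the central edge. If $T$ is not separated, let $L_i$ be the lexicographically ordered list of all port sequences of length at most $2h-1$ obtained by following simple paths from $c_i$ (a sequence of odd length ends with an outgoing port). An advice for $T$ is a binary string that encodes (by a self-delimiting code) $D$, one bit telling whether $T$ is separated, and integers $j,k,m,p$ such that for some $i\in\{0,1\}$: the $j$-th sequence $s$ of $L_i$ does not appear in $L_{1-i}$; $k$ is the largest length of a common prefix of $s$ and of the $j$-th sequence of $L_{1-i}$ (taken to be empty if it does not exist); $m$ is the $(k+1)$-th port number of $s$; and $p$ is the port leading from $c_{1-i}$ to $c_i$. **Algorithm OddElect.** Node $v$ reads the advice and uses $D-2$ rounds to learn $V(v,D-2)$. *Stage 1.* If $v$ has no endless path, then $e$ is the central edge of $V(v,D-2)$ and $\mathrm{cand}(v)$ is the endpoint of $e$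 closest to $v$. Otherwise $\mathrm{cand}(v)$ is the node on the path from $v$ to $g_v$ at distance $\ell$ from $v$, where $\ell=h-1$ if $V(v,D-2)$ contains a node $w$ with $d(w,g_v)>d(v,g_v)$, and $\ell=h$ otherwise. *Stage 2.* If the separated bit is 1, then (if $e$ is not yet defined) $e$ is the edge incident to $\mathrm{cand}(v)$ that leads away from $v$ and lies on all endless paths of $v$, and $L_v$ is the ordered list of the sequences $\mathrm{seq}(\mathrm{cand}(v),v')$ over all $v'$ in $V(v,D-2)$ for which the path from $\mathrm{cand}(v)$ to $v'$ does not contain $e$. If the bit is 0, $L_v$ is the ordered list of the port sequences of length at most $2h-1$ that correspond to simple paths from $\mathrm{cand}(v)$, computed from $V(v,D-2)$. *Stage 3.* If the $(k+1)$-th port number of the $j$-th sequence in $L_v$ exists and equals $m$, then $v$ outputs the outgoing ports of $\mathrm{seq}(v,\mathrm{cand}(v))$; otherwise it outputs the same sequence with $p$ appended. **Theorem.** There is a constant $C$ such that the following holds. 1. For every tree $T$ with $n\neq 4$ nodes, odd diameter $D$ and $\xi(T)\le D-2$: an advice for $T$ as above exists, and every such advice has size at most $C\log n$, and with it OddElect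 solves leader election in $T$ in time $D-2$. 2. There is one algorithm with advice such that for every tree $T$ with $n$ nodes (including $n=4$), odd diameter $D$ and $\xi(T)\le D-2$, some advice of size at most $C\log n$ makes it solve leader election in $T$ in time $D-2$. (The only tree with four nodes and odd diameter $D\geq 3$ is the path with $D=3$.) -/

import Mathlib

universe u

/-! ### Port-numbered trees -/

/-- An anonymous tree network with port numbers: at each node `v` of degree `d`, the incident edges
carry distinct port numbers, which are exactly `0, …, d - 1`.  The number of the edge `{v, w}` at
its endpoint `v` is `port v w` (only meaningful for adjacent `v`, `w`). -/
structure PortTree (V : Type u) where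
  graph : SimpleGraph V
  isTree : graph.IsTree
  port : V → V → ℕ
  port_bijOn : ∀ v, Set.BijOn (port v) (graph.neighborSet v) (Set.Iio (graph.neighborSet v).ncard)

/-- The information that a node has after some number of rounds, up to isomorphism.  A node `y` of
the visible subtree is named by its address, the sequence of all ports encountered on the simple
path from the centre `x` of the view to `y` (at each step the outgoing port, then the incoming
port); the view is the set of pairs (address of `y`, degree of `y`).  The addresses determine the
visible subtree and all ports on it; so two views are equal if and only if there is an isomorphism
of the visible subtrees that maps centre to centre and preserves ports and degrees. -/
abbrev View := Finset (List ℕ × ℕ)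

/-- A deterministic local algorithm: what a node does after `r` rounds is a function of `r` and of
its view at that time.  It either continues (`none`) or stops with an output (`some P`). -/
abbrev LocalAlgorithm := ℕ → View → Option (List ℕ)

namespace PortTree

variable {V : Type u} (T : PortTree V)

/-- Degree of a node. -/
noncomputable def degree (v : V) : ℕ := (T.graph.neighborSet v).ncard

/-- Diameter of the tree. -/
noncomputable def diam : ℕ := T.graph.diam

/-- The sequence of outgoing ports of a walk. -/
def outPorts {a b : V} (p : T.graph.Walk a b) : List ℕ :=
  p.darts.map fun d => T.port d.fst d.snd

/-- The unique simple path from `a` to `b`. -/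
noncomputable def path (a b : V) : T.graph.Walk a b := (T.isTree.existsUnique_path a b).choose

/-- The sequence of all ports encountered on the simple path from `a` to `b`: for each edge, first
the port at the node that is left, then the port at the node that is entered. -/
noncomputable def seq (a b : V) : List ℕ :=
  (T.path a b).darts.flatMap fun d => [T.port d.fst d.snd, T.port d.snd d.fst]

open Classical in
/-- The view acquired by `x` in `r` rounds. -/
noncomputable def view [Fintype V] (x : V) (r : ℕ) : View :=
  (Finset.univ.filter fun y => T.graph.dist x y ≤ r).image fun y => (T.seq x y, T.degree y)

/-! ### Leader election -/

/-- Taking the members of `P` as outgoing ports, starting at `v`, gives a simple path from `v`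
to `l`. -/
def LeadsTo (v : V) (P : List ℕ) (l : V) : Prop :=
  ∃ p : T.graph.Walk v l, p.IsPath ∧ T.outPorts p = P

/-- In the execution of `alg` in `T`, node `v` stops within `τ` rounds, with output `P`. -/
def Outputs [Fintype V] (alg : LocalAlgorithm) (τ : ℕ) (v : V) (P : List ℕ) : Prop :=
  ∃ r ≤ τ, alg r (T.view v r) = some P ∧ ∀ r' < r, alg r' (T.view v r') = none

/-- `alg` solves leader election in `T` in time `τ`: within `τ` rounds every node stops, and all
outputs describe simple paths that end at a common node, the leader. -/
def Solves [Fintype V] (alg : LocalAlgorithm) (τ : ℕ) : Prop :=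
  ∃ leader : V, ∀ v, ∃ P, T.Outputs alg τ v P ∧ T.LeadsTo v P leader

/-- The minimum time in which leader election is feasible in `T` when each node is given the map of
`T` without its own position (so the algorithm may depend on `T`, but is the same at all nodes);
it is `⊤` if leader election is not feasible at all. -/
noncomputable def xi [Fintype V] : ℕ∞ :=
  sInf {t : ℕ∞ | ∃ τ : ℕ, t = τ ∧ ∃ alg : LocalAlgorithm, T.Solves alg τ}

/-! ### Central edge and separated trees -/

/-- `{a, b}` is the central edge of the tree, of odd diameter: it is the middle edge of every simple
path whose length is the diameter. -/
def IsCentralEdge (a b : V) : Prop :=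
  T.graph.Adj a b ∧ ∀ (x y : V) (p : T.graph.Walk x y), p.IsPath → p.length = T.diam →
    s(p.getVert ((T.diam - 1) / 2), p.getVert ((T.diam - 1) / 2 + 1)) = s(a, b)

/-- The path from `v` to `y` is an endless path in the view of `v` of radius `r`: it has length `r`,
and `y` is not a leaf. -/
def IsEndless (r : ℕ) (v y : V) : Prop := T.graph.dist v y = r ∧ T.degree y ≠ 1

/-- All endless paths in the view of `v` of radius `r` pass through the node `g` of this view. -/
def OnAllEndless (r : ℕ) (v g : V) : Prop :=
  T.graph.dist v g ≤ r ∧ ∀ y, T.IsEndless r v y → g ∈ (T.path v y).support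

/-- `g` is the gateway of `v`: the node furthest from `v` through which all endless paths pass. -/
def IsGateway (r : ℕ) (v g : V) : Prop :=
  T.OnAllEndless r v g ∧ ∀ g', T.OnAllEndless r v g' → T.graph.dist v g' ≤ T.graph.dist v g

/-- `T`, with central edge `{c₀, c₁}`, is separated: for every node, the path to its gateway
contains the central edge. -/
def Separated (c₀ c₁ : V) : Prop :=
  ∀ v g, T.IsGateway (T.diam - 2) v g → s(c₀, c₁) ∈ (T.path v g).edges

/-! ### The lists of port sequences of the two candidates -/

open Classical in
/-- For an endpoint `c` of the central edge `{c, c'}`: the port sequences of all simple paths that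
start at `c` and do not contain the central edge, in lexicographic order. -/
noncomputable def sepList [Fintype V] (c c' : V) : List (List ℕ) :=
  ((Finset.univ.filter fun y => s(c, c') ∉ (T.path c y).edges).image fun y => T.seq c y).sort

open Classical in
/-- All port sequences of length at most `D - 2` (which is `2h - 1` if `D = 2h + 1`) that are
obtained by following simple paths from `c`, in lexicographic order.  A sequence of odd length ends
with an outgoing port. -/
noncomputable def shortList [Fintype V] (c : V) : List (List ℕ) :=
  ((Finset.univ ×ˢ Finset.range (T.diam - 2 + 1)).image fun q : V × ℕ =>
    (T.seq c q.1).take q.2).sort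

open Classical in
/-- The list of the endpoint `c` of the central edge `{c, c'}`. -/
noncomputable def candList [Fintype V] (c c' : V) : List (List ℕ) :=
  if T.Separated c c' then T.sepList c c' else T.shortList c

end PortTree

/-! ### The advice -/

/-- The content of the advice: the diameter, the separated bit and the tuple `(j, k, m, p)`. -/
structure OddAdvice where
  diam : ℕ
  sep : Bool
  j : ℕ
  k : ℕ
  m : ℕ
  p : ℕ

/-- A self-delimiting binary code of a natural number: each binary digit is preceded by a `true`,
and a `false` marks the end. -/
def encodeNat (n : ℕ) : List Bool := (n.bits.flatMap fun b => [true, b]) ++ [false]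

/-- Reads the code of a natural number from the beginning of a string. -/
def decodeNat : List Bool → ℕ × List Bool
  | true :: b :: l => (Nat.bit b (decodeNat l).1, (decodeNat l).2)
  | _ :: l => (0, l)
  | [] => (0, [])

/-- The advice as a single binary string. -/
def OddAdvice.encode (a : OddAdvice) : List Bool :=
  a.sep :: (encodeNat a.diam ++ encodeNat a.j ++ encodeNat a.k ++ encodeNat a.m ++ encodeNat a.p)

/-- Retrieves the content of the advice from the string. -/
def OddAdvice.decode (s : List Bool) : OddAdvice :=
  let d := decodeNat s.tail
  let j := decodeNat d.2
  let k := decodeNat j.2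
  let m := decodeNat k.2
  let p := decodeNat m.2
  ⟨d.1, s.headD false, j.1, k.1, m.1, p.1⟩

theorem decodeNat_encodeNat (n : ℕ) (l : List Bool) :
    decodeNat (encodeNat n ++ l) = (n, l) := by
  induction n using Nat.binaryRec' generalizing l with
  | zero => simp [encodeNat, decodeNat]
  | bit b n h ih =>
    have e : encodeNat (Nat.bit b n) = true :: b :: encodeNat n := by
      simp [encodeNat, Nat.bits_append_bit n b h]
    rw [e, List.cons_append, List.cons_append, decodeNat, ih]

theorem OddAdvice.decode_encode (a : OddAdvice) : OddAdvice.decode a.encode = a := by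
  have h : (decodeNat (encodeNat a.p)).1 = a.p := by
    simpa using congrArg Prod.fst (decodeNat_encodeNat a.p [])
  simp [OddAdvice.decode, OddAdvice.encode, decodeNat_encodeNat, List.append_assoc, h]

/-- `a` is a content of the advice that the oracle may give for `T`.  Here `{c₀, c₁}` is the central
edge, `s` is the `j`-th sequence in the list of `c₀`, it does not appear in the list of `c₁`, `k` is
the largest length of a common prefix of `s` and of the `j`-th sequence in the list of `c₁`, the
`(k+1)`-th port number of `s` is `m`, and `p` is the port that leads from `c₁` to `c₀`.  Positions
in the lists of sequences are counted from zero.  If the list of `c₁` has no `j`-th sequence, the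
empty sequence is taken instead. -/
def PortTree.IsOddAdvice {V : Type u} [Fintype V] (T : PortTree V) (a : OddAdvice) : Prop :=
  ∃ (c₀ c₁ : V) (s : List ℕ),
    T.IsCentralEdge c₀ c₁ ∧
    a.diam = T.diam ∧
    (a.sep = true ↔ T.Separated c₀ c₁) ∧
    (T.candList c₀ c₁)[a.j]? = some s ∧
    s ∉ T.candList c₁ c₀ ∧
    IsGreatest {k | k ≤ s.length ∧ k ≤ ((T.candList c₁ c₀).getD a.j []).length ∧
      s.take k = ((T.candList c₁ c₀).getD a.j []).take k} a.k ∧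
    s[a.k]? = some a.m ∧
    a.p = T.port c₁ c₀

/-! ### Operations on views

A node of a view is given by its address; the centre has the address `[]`.  The nodes on the path
from the centre to a node `a` are those whose addresses are prefixes of `a`. -/

/-- The length of the longest common prefix. -/
def commonLen : List ℕ → List ℕ → ℕ
  | x :: a, y :: b => if x = y then commonLen a b + 1 else 0
  | _, _ => 0

/-- The port sequence of the path between the nodes with addresses `a` and `b`. -/
def addrSeq (a b : List ℕ) : List ℕ :=
  (a.drop (commonLen a b)).reverse ++ b.drop (commonLen a b)

/-- The distance between the nodes with addresses `a` and `b`. -/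
def addrDist (a b : List ℕ) : ℕ := (addrSeq a b).length / 2

/-- The outgoing ports (odd-indexed terms) of a port sequence. -/
def outgoing : List ℕ → List ℕ
  | p :: _ :: l => p :: outgoing l
  | _ => []

namespace View

variable (W : View)

/-- The (addresses of the) nodes of the view. -/
def nodes : Finset (List ℕ) := W.image Prod.fst

/-- The ends of the endless paths that start at the centre of the view of radius `r`: the nodes at
distance `r` that are not leaves. -/
def endless (r : ℕ) : Finset (List ℕ) :=
  W.nodes.filter fun a => addrDist [] a = r ∧ (a, 1) ∉ W

/-- `(a, b)` are the nodes in the middle of the path from `x` to `y`, of length `2 * h + 1`. -/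
def IsMiddle (h : ℕ) (x y a b : List ℕ) : Prop :=
  addrDist x a = h ∧ addrDist a b = 1 ∧ addrDist b y = h

/-- `{a, b}` is the central edge of the view, if the view is a whole tree of odd diameter `D`. -/
def IsCentral (D : ℕ) (a b : List ℕ) : Prop :=
  a ∈ W.nodes ∧ b ∈ W.nodes ∧ ∀ x ∈ W.nodes, ∀ y ∈ W.nodes, addrDist x y = D →
    IsMiddle ((D - 1) / 2) x y a b ∨ IsMiddle ((D - 1) / 2) x y b a

/-- `g` is the gateway: the node furthest from the centre of the view through which all endless
paths pass. -/
def IsGateway (r : ℕ) (g : List ℕ) : Prop :=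
  g ∈ W.nodes ∧ (∀ a ∈ W.endless r, g <+: a) ∧
    ∀ g' ∈ W.nodes, (∀ a ∈ W.endless r, g' <+: a) → addrDist [] g' ≤ addrDist [] g

open Classical in
/-- Stage 1, if there are endless paths: the candidate is the node at distance `ℓ` on the path from
the centre of the view to its gateway.  (`Classical.epsilon` picks a node with the stated property;
there is only one.) -/
noncomputable def candOfGateway (D : ℕ) : List ℕ :=
  let g := Classical.epsilon fun g => W.IsGateway (D - 2) g
  let ℓ := if ∃ w ∈ W.nodes, addrDist w g > addrDist [] g then (D - 1) / 2 - 1 else (D - 1) / 2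
  Classical.epsilon fun c => c ∈ W.nodes ∧ c <+: g ∧ addrDist [] c = ℓ

/-- The other endpoint of the edge incident to the candidate `c` that leads away from the centre of
the view and lies on all endless paths. -/
noncomputable def nextOnEndless (D : ℕ) (c : List ℕ) : List ℕ :=
  Classical.epsilon fun b => b ∈ W.nodes ∧ addrDist c b = 1 ∧ c <+: b ∧
    ∀ a ∈ W.endless (D - 2), b <+: a

open Classical in
/-- The candidate of the centre of the view, and the other endpoint of the edge `e`.  Without
endless paths, `e` is the central edge of the view, and the candidate is its closest endpoint.  (The
second component is used only if the tree is separated.) -/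
noncomputable def candidate (D : ℕ) : List ℕ × List ℕ :=
  if W.endless (D - 2) = ∅ then
    Classical.epsilon fun e : List ℕ × List ℕ =>
      W.IsCentral D e.1 e.2 ∧ addrDist [] e.1 < addrDist [] e.2
  else (W.candOfGateway D, W.nextOnEndless D (W.candOfGateway D))

open Classical in
/-- In the separated case: the ordered list of the port sequences from `c` to all nodes that are
reached from `c` without the edge between `c` and its neighbour `c'`.  As `c'` is further from the
centre of the view than `c`, these are the nodes that are not reached from the centre through
`c'`. -/
noncomputable def sepList (c c' : List ℕ) : List (List ℕ) :=
  ((W.nodes.filter fun b => ¬ c' <+: b).image fun b => addrSeq c b).sort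

open Classical in
/-- In the other case: the ordered list of the port sequences of length at most `D - 2` that
correspond to paths from `c`.  The sequences of odd length are found from the degrees: they consist
of the sequence from `c` to a node and of a port at this node other than the one of arrival. -/
noncomputable def shortList (D : ℕ) (c : List ℕ) : List (List ℕ) :=
  ((W.biUnion fun b => insert (addrSeq c b.1)
    (((Finset.range b.2).filter fun q => (addrSeq c b.1).getLast? ≠ some q).image fun q =>
      addrSeq c b.1 ++ [q])).filter fun s => s.length ≤ D - 2).sort

end View

/-! ### The algorithm -/

open Classical in
/-- What the centre of the view `W` of radius `D - 2` outputs in algorithm OddElect with the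
advice `a`, where `D` is the diameter given in the advice. -/
noncomputable def oddElectOutput (a : OddAdvice) (W : View) : List ℕ :=
  let c := (W.candidate a.diam).1
  let c' := (W.candidate a.diam).2
  let L := if a.sep = true then W.sepList c c' else W.shortList a.diam c
  let electMyCandidate : Prop := ∃ s, L[a.j]? = some s ∧ s[a.k]? = some a.m
  if electMyCandidate then outgoing c else outgoing c ++ [a.p]

/-- Algorithm OddElect, given an advice string: communicate for `D - 2` rounds, then stop. -/
noncomputable def OddElect (A : List Bool) : LocalAlgorithm := fun r W =>
  if r = (OddAdvice.decode A).diam - 2 then some (oddElectOutput (OddAdvice.decode A) W) else none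

/-! Write `D = 2h + 1`. The central edge `{c, c'}` cuts the tree into two sides of depth exactly
`h`, and nodes at depth `h` are leaves. Port sequences from a fixed root name the nodes faithfully:
prefixes are nodes on the path (`seq_isPrefix_iff`), and the sequence between two nodes is
computable from their addresses (`addrSeq_seq`). So every step of the algorithm on views translates
into a statement about the tree.

Correctness. An endless path has length `2h - 1` and ends at depth at most `h - 1`, so it starts at
depth `h` or `h - 1` and passes through the near end `c` (`IsCenter.endless_cases`). Hence each node
finds its near end as candidate, and it sees enough of the tree to compute exactly that end's list
(`sepList_view`, `shortList_view`). Position `k` of the `j`-th sequence then tells the two sides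
apart.

Existence. If both lists have the same members, election in time `D - 2` is impossible. The
obstruction is parity: nodes with equal views output paths of equal length to the leader, so their
distance is even (`Solves.even_dist`). In a separated tree, equal lists make the two sides
isomorphic, so `c` and `c'` have equal views at distance 1. Otherwise some gateway stays on its own
side; for `n ≠ 4` this yields two leaves of depth `h` in different branches at `c`. One of them
avoids the branch whose port equals that of the central edge at `c'`; it has a copy beyond the
central edge with the same view of radius `2h - 1`, at odd distance `2h + 1`.

The path with four nodes is treated separately: election is feasible only if its central edge has
different ports, and then these ports choose the leader. -/

namespace PortTree

variable {V : Type u} (T : PortTree V)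

/-! ### Paths, distances and betweenness -/

/-- The node `x` lies on the path from `a` to `b`. -/
def Between (a x b : V) : Prop := T.graph.dist a x + T.graph.dist x b = T.graph.dist a b

theorem path_isPath (a b : V) : (T.path a b).IsPath :=
  (T.isTree.existsUnique_path a b).choose_spec.1

theorem eq_path {a b : V} {p : T.graph.Walk a b} (hp : p.IsPath) : p = T.path a b :=
  (T.isTree.existsUnique_path a b).unique hp (T.path_isPath a b)

theorem length_path (a b : V) : (T.path a b).length = T.graph.dist a b := by
  obtain ⟨p, hp, hl⟩ := T.isTree.connected.exists_path_of_dist a b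
  rw [← T.eq_path hp, hl]

theorem eq_path_of_length {a b : V} {p : T.graph.Walk a b} (h : p.length = T.graph.dist a b) :
    p = T.path a b :=
  T.eq_path (p.isPath_of_length_eq_dist h)

theorem length_of_isPath {a b : V} {p : T.graph.Walk a b} (hp : p.IsPath) :
    p.length = T.graph.dist a b := by
  rw [T.eq_path hp, length_path]

theorem dist_triangle (a b c : V) : T.graph.dist a c ≤ T.graph.dist a b + T.graph.dist b c :=
  T.isTree.connected.dist_triangle

theorem dist_eq_zero {a b : V} : T.graph.dist a b = 0 ↔ a = b :=
  T.isTree.connected.dist_eq_zero_iff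

theorem dist_adj (u : V) {v w : V} (h : T.graph.Adj v w) :
    T.graph.dist u v = T.graph.dist u w + 1 ∨ T.graph.dist u w = T.graph.dist u v + 1 :=
  T.isTree.dist_eq_dist_add_one_of_adj u h

variable {T}

theorem Between.path_eq {a x b : V} (h : T.Between a x b) :
    T.path a b = (T.path a x).append (T.path x b) := by
  symm
  apply T.eq_path_of_length
  rw [SimpleGraph.Walk.length_append, length_path, length_path]
  exact h

theorem Between.symm {a x b : V} (h : T.Between a x b) : T.Between b x a := by
  unfold Between at *
  simp only [SimpleGraph.dist_comm (u := b), SimpleGraph.dist_comm (v := a)]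
  omega

theorem mem_support_path {a x b : V} : x ∈ (T.path a b).support ↔ T.Between a x b := by
  classical
  constructor
  · intro hx
    have h1 := congrArg SimpleGraph.Walk.length ((T.path a b).take_spec hx)
    rw [SimpleGraph.Walk.length_append, T.length_of_isPath ((T.path_isPath a b).takeUntil hx),
      T.length_of_isPath ((T.path_isPath a b).dropUntil hx), length_path] at h1
    exact h1
  · intro h
    rw [h.path_eq, SimpleGraph.Walk.mem_support_append_iff]
    exact Or.inl (SimpleGraph.Walk.end_mem_support _)

theorem between_left (a b : V) : T.Between a a b := by simp [Between]

theorem between_right (a b : V) : T.Between a b b := by simp [Between]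

theorem Between.seq_eq {a x b : V} (h : T.Between a x b) :
    T.seq a b = T.seq a x ++ T.seq x b := by
  unfold seq
  rw [h.path_eq, SimpleGraph.Walk.darts_append, List.flatMap_append]

theorem path_self (a : V) : T.path a a = SimpleGraph.Walk.nil :=
  (T.eq_path SimpleGraph.Walk.IsPath.nil).symm

theorem path_adj {a b : V} (h : T.graph.Adj a b) :
    T.path a b = SimpleGraph.Walk.cons h SimpleGraph.Walk.nil := by
  symm
  apply T.eq_path_of_length
  rw [SimpleGraph.dist_eq_one_iff_adj.2 h]
  rfl

theorem path_symm (a b : V) : T.path b a = (T.path a b).reverse :=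
  (T.eq_path ((T.path_isPath a b).reverse)).symm

@[simp] theorem seq_self (a : V) : T.seq a a = [] := by simp [seq, path_self]

theorem seq_adj {a b : V} (h : T.graph.Adj a b) : T.seq a b = [T.port a b, T.port b a] := by
  simp [seq, path_adj h]

theorem length_seq (a b : V) : (T.seq a b).length = 2 * T.graph.dist a b := by
  rw [seq, List.length_flatMap, ← length_path]
  simp [mul_comm]

theorem seq_symm (a b : V) : T.seq b a = (T.seq a b).reverse := by
  unfold seq
  rw [path_symm a b, SimpleGraph.Walk.darts_reverse]
  generalize (T.path a b).darts = l
  induction l with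
  | nil => rfl
  | cons d l ih => simp [List.flatMap_append, ih]

theorem outgoing_seq (a b : V) : outgoing (T.seq a b) = T.outPorts (T.path a b) := by
  unfold seq outPorts
  generalize (T.path a b).darts = l
  induction l with
  | nil => rfl
  | cons d l ih => simp [outgoing, ih]

theorem dist_of_adj {a b : V} (h : T.graph.Adj a b) : T.graph.dist a b = 1 :=
  SimpleGraph.dist_eq_one_iff_adj.2 h

theorem exists_adj_dist {a b : V} (h : a ≠ b) :
    ∃ z, T.graph.Adj a z ∧ T.graph.dist a b = T.graph.dist z b + 1 := by
  have hl := T.length_path a b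
  have hp := T.path_isPath a b
  cases hpath : T.path a b with
  | nil => exact absurd rfl h
  | cons hadj q =>
    rename_i z
    rw [hpath] at hl hp
    refine ⟨z, hadj, ?_⟩
    rw [← hl, SimpleGraph.Walk.length_cons, T.length_of_isPath hp.of_cons]

theorem between_of_adj {a z b : V} (h : T.graph.Adj a z)
    (hd : T.graph.dist a b = T.graph.dist z b + 1) : T.Between a z b := by
  have := dist_of_adj h
  unfold Between
  omega

/-- Joining the two paths by the edge gives a simple path: a node on both would be closer to `c`
than to `c'` and also closer to `c'` than to `c`. -/
theorem dist_of_cross {c c' x y : V} (h : T.graph.Adj c c')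
    (hx : T.graph.dist x c' = T.graph.dist x c + 1)
    (hy : T.graph.dist y c = T.graph.dist y c' + 1) :
    T.graph.dist x y = T.graph.dist x c + 1 + T.graph.dist c' y := by
  have key : ((T.path x c).append (SimpleGraph.Walk.cons h (T.path c' y))).IsPath := by
    rw [SimpleGraph.Walk.isPath_def, SimpleGraph.Walk.support_append,
      SimpleGraph.Walk.support_cons, List.tail_cons, List.nodup_append]
    refine ⟨(T.path_isPath _ _).support_nodup, (T.path_isPath _ _).support_nodup, ?_⟩
    rintro a ha b hb rfl
    rw [mem_support_path] at ha hb
    unfold Between at ha hb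
    have h1 := T.dist_triangle x a c'
    have h2 := T.dist_triangle y a c
    simp only [T.graph.dist_comm (u := y), T.graph.dist_comm (u := a) (v := c),
      T.graph.dist_comm (u := a) (v := c')] at *
    have h3 := T.dist_adj a h
    simp only [T.graph.dist_comm (u := a) (v := c),
      T.graph.dist_comm (u := a) (v := c')] at *
    omega
  have := T.length_of_isPath key
  rw [← this, SimpleGraph.Walk.length_append, SimpleGraph.Walk.length_cons, length_path,
    length_path]
  omega

/-! ### Port sequences as addresses of nodes -/

theorem port_inj {v a b : V} (ha : T.graph.Adj v a) (hb : T.graph.Adj v b)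
    (h : T.port v a = T.port v b) : a = b :=
  (T.port_bijOn v).injOn ha hb h

theorem port_lt {v a : V} (ha : T.graph.Adj v a) : T.port v a < T.degree v :=
  (T.port_bijOn v).mapsTo ha

theorem exists_port {v : V} {q : ℕ} (h : q < T.degree v) : ∃ w, T.graph.Adj v w ∧ T.port v w = q :=
  (T.port_bijOn v).surjOn h

/-- Ports at a node are distinct, so equal first ports mean equal first steps, and one can follow
the two paths together. This is the dictionary between lists and tree geometry. -/
theorem seq_isPrefix_iff {v x y : V} : T.seq v x <+: T.seq v y ↔ T.Between v x y := by
  constructor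
  · intro h
    induction hn : T.graph.dist v x generalizing v with
    | zero =>
      rw [T.dist_eq_zero] at hn
      subst hn
      exact between_left _ _
    | succ n ih =>
      have hvx : v ≠ x := by
        rintro rfl
        simp at hn
      obtain ⟨z, hz, hzd⟩ := exists_adj_dist hvx
      rw [(between_of_adj hz hzd).seq_eq, seq_adj hz] at h
      have hvy : v ≠ y := by
        rintro rfl
        simp at h
      obtain ⟨w, hw, hwd⟩ := exists_adj_dist hvy
      rw [(between_of_adj hw hwd).seq_eq, seq_adj hw] at h
      simp only [List.cons_append, List.nil_append, List.cons_prefix_cons] at h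
      obtain ⟨h1, -, h3⟩ := h
      obtain rfl := port_inj hz hw h1
      have := ih h3 (by omega)
      unfold Between at *
      omega
  · intro h
    rw [h.seq_eq]
    exact List.prefix_append _ _

theorem seq_injective (v : V) : Function.Injective (T.seq v) := by
  intro x y h
  have h1 : T.Between v x y := seq_isPrefix_iff.1 (h ▸ List.prefix_rfl)
  have h2 := congrArg List.length h
  rw [length_seq, length_seq] at h2
  unfold Between at h1
  exact T.dist_eq_zero.1 (by omega)

theorem Between.trans_right {v m z x : V} (h : T.Between v m x) (h' : T.Between m z x) :
    T.Between v z x := by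
  have := T.dist_triangle v z x
  have := T.dist_triangle v m z
  unfold Between at *
  omega

theorem Between.dist_trans {v m z x : V} (h : T.Between v m x) (h' : T.Between m z x) :
    T.Between v m z := by
  have := T.dist_triangle v z x
  have := T.dist_triangle v m z
  unfold Between at *
  omega

/-- Take the last common node of the two paths from `v`. The next edge towards `x` separates `x`
from `y`, so the path from `x` to `y` turns at `m`. The last clause makes the first ports towards
`x` and `y` differ. -/
theorem exists_median (v x y : V) :
    ∃ m, T.Between v m x ∧ T.Between v m y ∧ T.Between x m y ∧
      ∀ a, T.graph.Adj m a → T.Between m a x → ¬ T.Between m a y := by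
  let P : ℕ → Prop := fun k => ∃ m, T.Between v m x ∧ T.Between v m y ∧ T.graph.dist v m = k
  classical
  have h0 : P 0 := ⟨v, between_left _ _, between_left _ _, by simp⟩
  obtain ⟨m, hx, hy, hm⟩ := Nat.findGreatest_spec (Nat.zero_le (T.graph.dist v x)) h0
  have hmax : ∀ a, T.graph.Adj m a → T.Between m a x → ¬ T.Between m a y := by
    intro a ha hax hay
    have h1 := hx.dist_trans hax
    have h2 := hx.trans_right hax
    have h3 : T.graph.dist v a ≤ Nat.findGreatest P (T.graph.dist v x) :=
      Nat.le_findGreatest (by unfold Between at h2; omega) ⟨a, h2, hy.trans_right hay, rfl⟩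
    have h4 := dist_of_adj ha
    unfold Between at h1
    omega
  refine ⟨m, hx, hy, ?_, hmax⟩
  by_cases hxm : m = x
  · subst hxm
    exact between_left _ _
  obtain ⟨a, ha, had⟩ := exists_adj_dist hxm
  have hax := between_of_adj ha had
  have hay := hmax a ha hax
  have hya : T.graph.dist y a = T.graph.dist y m + 1 := by
    rcases T.dist_adj y ha with h | h
    · exact absurd (between_of_adj ha (by
        rw [T.graph.dist_comm (u := m), T.graph.dist_comm (u := a)]; exact h)) hay
    · exact h
  have := dist_of_cross ha.symm (x := x) (y := y)
    (by rw [T.graph.dist_comm (u := x) (v := m), T.graph.dist_comm (u := x)]; exact had) hya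
  unfold Between
  rw [this, T.graph.dist_comm (u := x) (v := m), T.graph.dist_comm (u := x)]
  omega

theorem _root_.commonLen_append (a b c : List ℕ) :
    commonLen (a ++ b) (a ++ c) = a.length + commonLen b c := by
  induction a with
  | nil => simp
  | cons x a ih => simp [commonLen, ih]; omega

theorem _root_.commonLen_of_head {b c : List ℕ} (h : ∀ x, b.head? = some x → c.head? ≠ some x) :
    commonLen b c = 0 := by
  cases b with
  | nil => simp [commonLen]
  | cons x b =>
    cases c with
    | nil => simp [commonLen]
    | cons y c =>
      have := h x rfl
      simp only [List.head?_cons, ne_eq, Option.some.injEq] at this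
      simp [commonLen, Ne.symm this]

theorem head?_seq {v y : V} {q : ℕ} :
    (T.seq v y).head? = some q ↔ ∃ a, T.graph.Adj v a ∧ T.Between v a y ∧ T.port v a = q := by
  constructor
  · intro h
    have hne : v ≠ y := by
      rintro rfl
      simp at h
    obtain ⟨z, hz, hzd⟩ := exists_adj_dist hne
    have hb := between_of_adj hz hzd
    rw [hb.seq_eq, seq_adj hz] at h
    exact ⟨z, hz, hb, by simpa using h⟩
  · rintro ⟨a, ha, hb, rfl⟩
    rw [hb.seq_eq, seq_adj ha]
    rfl

/-- The longest common prefix of the two addresses is the address of the median, since the paths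
leave the median by different ports. Reversal exchanges outgoing and incoming ports, as it should.
-/
theorem addrSeq_seq (v x y : V) : addrSeq (T.seq v x) (T.seq v y) = T.seq x y := by
  obtain ⟨m, hx, hy, hxy, hm⟩ := T.exists_median v x y
  have h0 : commonLen (T.seq m x) (T.seq m y) = 0 := by
    apply commonLen_of_head
    intro q hq hq'
    obtain ⟨a, ha, hax, rfl⟩ := head?_seq.1 hq
    obtain ⟨b, hb, hby, hab⟩ := head?_seq.1 hq'
    obtain rfl := port_inj hb ha hab
    exact hm _ ha hax hby
  have hc : commonLen (T.seq v x) (T.seq v y) = (T.seq v m).length := by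
    rw [hx.seq_eq, hy.seq_eq, commonLen_append, h0, add_zero]
  rw [addrSeq, hc, hx.seq_eq, hy.seq_eq, List.drop_left, List.drop_left, hxy.seq_eq,
    ← seq_symm]

theorem addrDist_seq (v x y : V) : addrDist (T.seq v x) (T.seq v y) = T.graph.dist x y := by
  rw [addrDist, addrSeq_seq, length_seq]
  omega

theorem addrDist_nil_seq (v y : V) : addrDist [] (T.seq v y) = T.graph.dist v y := by
  rw [← seq_self (T := T) v, addrDist_seq]

theorem seq_of_adj {c y z : V} (h : T.graph.Adj y z)
    (hd : T.graph.dist c z = T.graph.dist c y + 1) :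
    T.seq c z = T.seq c y ++ [T.port y z, T.port z y] := by
  have hb : T.Between c y z := by
    have := dist_of_adj h
    unfold Between
    omega
  rw [hb.seq_eq, seq_adj h]

theorem adj_of_seq_eq_append {c y z : V} {q r : ℕ} (h : T.seq c z = T.seq c y ++ [q, r]) :
    T.graph.Adj y z ∧ T.graph.dist c z = T.graph.dist c y + 1 ∧ T.port y z = q ∧
      T.port z y = r := by
  have hb : T.Between c y z := seq_isPrefix_iff.1 (h ▸ List.prefix_append _ _)
  have hl := congrArg List.length h
  rw [List.length_append, length_seq, length_seq] at hl
  simp only [List.length_cons, List.length_nil] at hl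
  have hadj : T.graph.Adj y z := by
    rw [← SimpleGraph.dist_eq_one_iff_adj]
    unfold Between at hb
    omega
  have hd : T.graph.dist c z = T.graph.dist c y + 1 := by omega
  rw [seq_of_adj hadj hd] at h
  have := List.append_cancel_left h
  simp at this
  exact ⟨hadj, hd, this.1, this.2⟩

/-- Seen from `c`, each port at `y` either leads away from `c` or is the port of arrival. Thus
degrees can be compared through port sequences alone. -/
theorem lt_degree_iff (c y : V) (q : ℕ) :
    q < T.degree y ↔
      (∃ z r, T.seq c z = T.seq c y ++ [q, r]) ∨ (T.seq c y).getLast? = some q := by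
  constructor
  · intro h
    obtain ⟨z, hz, rfl⟩ := exists_port h
    rcases T.dist_adj c hz with h | h
    · right
      rw [seq_of_adj hz.symm h]
      simp
    · exact Or.inl ⟨z, _, seq_of_adj hz h⟩
  · rintro (⟨z, r, h⟩ | h)
    · obtain ⟨h1, -, h2, -⟩ := adj_of_seq_eq_append h
      exact h2 ▸ port_lt h1
    · have hne : y ≠ c := by
        rintro rfl
        simp at h
      obtain ⟨w, hw, hd⟩ := exists_adj_dist hne
      rw [seq_of_adj hw.symm (by
        rw [T.graph.dist_comm (u := c), T.graph.dist_comm (u := c)]; exact hd)] at h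
      simp only [List.getLast?_append_cons, List.getLast?_cons_cons, List.getLast?_singleton,
        Option.some.injEq] at h
      exact h ▸ port_lt hw

theorem getLast?_ne_of_seq_eq_append {c y z : V} {q r : ℕ}
    (h : T.seq c z = T.seq c y ++ [q, r]) : (T.seq c y).getLast? ≠ some q := by
  obtain ⟨h1, h2, rfl, rfl⟩ := adj_of_seq_eq_append h
  intro h3
  have hne : y ≠ c := by
    rintro rfl
    simp at h3
  obtain ⟨w, hw, hd⟩ := exists_adj_dist hne
  rw [seq_of_adj hw.symm (by
    rw [T.graph.dist_comm (u := c), T.graph.dist_comm (u := c)]; exact hd)] at h3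
  simp only [List.getLast?_append_cons, List.getLast?_cons_cons, List.getLast?_singleton,
    Option.some.injEq] at h3
  obtain rfl := port_inj hw h1 h3
  rw [T.graph.dist_comm (u := y), T.graph.dist_comm (u := w)] at hd
  omega

/-! ### The two sides of an edge -/

/-- The node `y` is closer to `c` than to its neighbour `c'`. -/
def Near (T : PortTree V) (c c' y : V) : Prop := T.graph.dist c' y = T.graph.dist c y + 1

theorem near_or {c c' : V} (h : T.graph.Adj c c') (y : V) : T.Near c c' y ∨ T.Near c' c y := by
  have := T.dist_adj y h
  unfold Near
  rw [T.graph.dist_comm (u := c), T.graph.dist_comm (u := c')]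
  exact this.symm

theorem Near.not_near {c c' y : V} (h : T.Near c c' y) : ¬ T.Near c' c y := by
  unfold Near at *
  omega

theorem near_self {c c' : V} (h : T.graph.Adj c c') : T.Near c c' c := by
  unfold Near
  simp [dist_of_adj h.symm]

theorem Near.dist_eq {c c' x y : V} (h : T.graph.Adj c c') (hx : T.Near c c' x)
    (hy : T.Near c' c y) :
    T.graph.dist x y = T.graph.dist c x + 1 + T.graph.dist c' y := by
  rw [dist_of_cross h (x := x) (y := y), T.graph.dist_comm (u := x)]
  · rw [T.graph.dist_comm (u := x), T.graph.dist_comm (u := x)]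
    exact hx
  · rw [T.graph.dist_comm (u := y), T.graph.dist_comm (u := y)]
    exact hy

theorem Near.between_left {c c' x y : V} (h : T.graph.Adj c c') (hx : T.Near c c' x)
    (hy : T.Near c' c y) : T.Between x c y := by
  have := hx.dist_eq h hy
  unfold Near at *
  unfold Between
  rw [T.graph.dist_comm (u := x) (v := c)]
  omega

theorem Near.between_right {c c' x y : V} (h : T.graph.Adj c c') (hx : T.Near c c' x)
    (hy : T.Near c' c y) : T.Between x c' y := by
  have := hx.dist_eq h hy
  unfold Near at *
  unfold Between
  rw [T.graph.dist_comm (u := x) (v := c')]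
  omega

theorem Near.not_between {c c' x y : V} (hx : T.Near c c' x) (hy : T.Near c c' y) :
    ¬ T.Between x c' y := by
  intro hb
  have := T.dist_triangle x c y
  unfold Near at *
  unfold Between at hb
  rw [T.graph.dist_comm (u := x) (v := c')] at hb
  rw [T.graph.dist_comm (u := x) (v := c)] at this
  omega

theorem between_iff_near {c c' x y : V} (h : T.graph.Adj c c') (hx : T.Near c c' x) :
    T.Between x c' y ↔ T.Near c' c y :=
  ⟨fun hb => (near_or h y).resolve_left fun hy => hx.not_between hy hb,
    fun hy => hx.between_right h hy⟩

theorem mem_edges_path_of_near {c c' x y : V} (h : T.graph.Adj c c') (hx : T.Near c c' x) :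
    s(c, c') ∈ (T.path x y).edges ↔ T.Near c' c y := by
  constructor
  · intro he
    have := SimpleGraph.Walk.snd_mem_support_of_mem_edges _ he
    rw [mem_support_path] at this
    exact (between_iff_near h hx).1 this
  · intro hy
    have hb : T.Between c c' y := (near_self h).between_right h hy
    rw [(hx.between_left h hy).path_eq, hb.path_eq, path_adj h]
    simp

theorem seq_of_near {c c' y : V} (h : T.graph.Adj c c') (hy : T.Near c' c y) :
    T.seq c y = T.port c c' :: T.port c' c :: T.seq c' y := by
  rw [((near_self h).between_right h hy).seq_eq, seq_adj h]
  rfl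

theorem near_iff_head?_seq {c c' y : V} (h : T.graph.Adj c c') :
    T.Near c' c y ↔ (T.seq c y).head? = some (T.port c c') := by
  constructor
  · intro hy
    rw [seq_of_near h hy]
    rfl
  · intro hh
    obtain ⟨a, ha, hb, hp⟩ := head?_seq.1 hh
    obtain rfl := port_inj ha h hp
    exact (between_iff_near h (near_self h)).1 hb

/-! ### The central edge -/

/-- `{c, c'}` is an edge that divides the tree into two parts of depth exactly `h`; so it is the
central edge, and the diameter is `2 * h + 1`. -/
structure IsCenter (T : PortTree V) (h : ℕ) (c c' : V) : Prop where
  adj : T.graph.Adj c c'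
  diam : T.diam = 2 * h + 1
  depth : ∀ y, T.Near c c' y → T.graph.dist c y ≤ h
  depth' : ∀ y, T.Near c' c y → T.graph.dist c' y ≤ h
  deep : ∃ y, T.Near c c' y ∧ T.graph.dist c y = h
  deep' : ∃ y, T.Near c' c y ∧ T.graph.dist c' y = h

theorem IsCenter.symm {h : ℕ} {c c' : V} (H : T.IsCenter h c c') : T.IsCenter h c' c :=
  ⟨H.adj.symm, H.diam, H.depth', H.depth, H.deep', H.deep⟩

theorem dist_le_diam [Finite V] (x y : V) : T.graph.dist x y ≤ T.diam := by
  have := T.isTree.connected.nonempty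
  exact SimpleGraph.dist_le_diam (SimpleGraph.connected_iff_ediam_ne_top.1 T.isTree.connected)

theorem exists_dist_eq_diam (T : PortTree V) : ∃ x y : V, T.graph.dist x y = T.diam :=
  haveI := T.isTree.connected.nonempty
  SimpleGraph.exists_dist_eq_diam

theorem dist_getVert {x y : V} {p : T.graph.Walk x y} (hp : p.IsPath) {i : ℕ} (hi : i ≤ p.length) :
    T.graph.dist x (p.getVert i) = i ∧ T.graph.dist (p.getVert i) y = p.length - i := by
  rw [← T.length_of_isPath (hp.take i), ← T.length_of_isPath (hp.drop i)]
  simp [SimpleGraph.Walk.take_length, SimpleGraph.Walk.drop_length, hi]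

/-- A node deeper than `h` on one side, joined across the edge to the end of `p` on the other side,
would exceed the diameter. -/
theorem isCenter_of_diametral [Finite V] {h : ℕ} (hd : T.diam = 2 * h + 1) {x y : V}
    {p : T.graph.Walk x y} (hp : p.IsPath) (hl : p.length = T.diam) :
    T.IsCenter h (p.getVert h) (p.getVert (h + 1)) := by
  have h1 := dist_getVert hp (i := h) (by omega)
  have h2 := dist_getVert hp (i := h + 1) (by omega)
  have hadj : T.graph.Adj (p.getVert h) (p.getVert (h + 1)) :=
    p.adj_getVert_succ (by omega)
  generalize p.getVert h = c at *
  generalize p.getVert (h + 1) = c' at *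
  have hx : T.Near c c' x := by
    unfold Near
    rw [T.graph.dist_comm, h2.1, T.graph.dist_comm, h1.1]
  have hy : T.Near c' c y := by
    unfold Near
    omega
  refine ⟨hadj, hd, fun z hz => ?_, fun z hz => ?_, ⟨x, hx, by rw [T.graph.dist_comm]; exact h1.1⟩,
    ⟨y, hy, by omega⟩⟩
  · have := hz.dist_eq hadj hy
    have := T.dist_le_diam z y
    omega
  · have := hz.dist_eq hadj.symm hx
    have := T.dist_le_diam z x
    have := T.graph.dist_comm (u := x) (v := c)
    omega

theorem exists_isCenter [Finite V] {h : ℕ} (hd : T.diam = 2 * h + 1) :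
    ∃ c c', T.IsCenter h c c' := by
  obtain ⟨x, y, hxy⟩ := T.exists_dist_eq_diam
  exact ⟨_, _, isCenter_of_diametral hd (T.path_isPath x y) (by rw [length_path, hxy])⟩

/-- The nodes at distance `h` and `h + 1` on a path of length `2 * h + 1` are the two ends of the
central edge. -/
theorem IsCenter.middle {h : ℕ} {c c' x y a b : V} (H : T.IsCenter h c c') (hx : T.Near c c' x)
    (hxy : T.graph.dist x y = 2 * h + 1) (ha : T.graph.dist x a = h)
    (hb : T.graph.dist b y = h) (hab : T.graph.dist a b = 1) : a = c ∧ b = c' := by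
  have hy : T.Near c' c y := by
    refine (near_or H.adj y).resolve_left fun hy => ?_
    have h1 := H.depth x hx
    have h2 := H.depth y hy
    have h3 := T.dist_triangle x c y
    rw [T.graph.dist_comm (u := x) (v := c)] at h3
    omega
  have h0 := hx.dist_eq H.adj hy
  have h1 := H.depth x hx
  have h2 := H.depth' y hy
  have ha' : T.Between x a y := by
    have h3 := T.dist_triangle x a y
    have h4 := T.dist_triangle a b y
    unfold Between
    omega
  have hb' : T.Between x b y := by
    have h3 := T.dist_triangle x b y
    have h4 := T.dist_triangle x a b
    unfold Between
    omega
  have key : ∀ z w, T.Between x z y → T.Between x w y → T.graph.dist x z = T.graph.dist x w →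
      z = w := by
    intro z w hz hw hzw
    have h5 := List.prefix_of_prefix_length_le (seq_isPrefix_iff.2 hz) (seq_isPrefix_iff.2 hw)
      (by rw [length_seq, length_seq, hzw])
    exact seq_injective x (h5.eq_of_length (by rw [length_seq, length_seq, hzw]))
  constructor
  · refine key _ _ ha' (hx.between_left H.adj hy) ?_
    rw [T.graph.dist_comm (u := x) (v := c)]
    omega
  · refine key _ _ hb' (hx.between_right H.adj hy) ?_
    unfold Near at hx
    unfold Between at hb'
    rw [T.graph.dist_comm (u := x) (v := c')]
    omega

theorem IsCenter.isCentralEdge {h : ℕ} {c c' : V} (H : T.IsCenter h c c') :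
    T.IsCentralEdge c c' := by
  refine ⟨H.adj, fun x y p hp hl => ?_⟩
  have hd := H.diam
  have e : (T.diam - 1) / 2 = h := by omega
  rw [e]
  have h1 := dist_getVert hp (i := h) (by omega)
  have h2 := dist_getVert hp (i := h + 1) (by omega)
  have hadj := p.adj_getVert_succ (i := h) (by omega)
  have hxy := T.length_of_isPath hp
  rcases near_or H.adj x with hx | hx
  · obtain ⟨h3, h4⟩ := H.middle (y := y) hx (by omega) h1.1 (by omega) (dist_of_adj hadj)
    rw [h3, h4]
  · obtain ⟨h3, h4⟩ := H.symm.middle (y := y) hx (by omega) h1.1 (by omega) (dist_of_adj hadj)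
    rw [h3, h4, Sym2.eq_swap]

theorem IsCentralEdge.isCenter [Finite V] {h : ℕ} {c c' : V} (hd : T.diam = 2 * h + 1)
    (H : T.IsCentralEdge c c') : T.IsCenter h c c' := by
  obtain ⟨x, y, hxy⟩ := T.exists_dist_eq_diam
  have h1 := H.2 x y _ (T.path_isPath x y) (by rw [length_path, hxy])
  have h2 := isCenter_of_diametral hd (T.path_isPath x y) (by rw [length_path, hxy])
  have e : (T.diam - 1) / 2 = h := by omega
  rw [e, Sym2.eq_iff] at h1
  rcases h1 with ⟨h3, h4⟩ | ⟨h3, h4⟩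
  · rwa [h3, h4] at h2
  · rw [h3, h4] at h2
    exact h2.symm

/-! ### Views and the obstruction to leader election -/

theorem mem_view [Fintype V] {v : V} {r : ℕ} {a : List ℕ × ℕ} :
    a ∈ T.view v r ↔ ∃ y, T.graph.dist v y ≤ r ∧ (T.seq v y, T.degree y) = a := by
  simp [view]

/-- Equal addresses have equal length, so copies lie at equal distance; a match at radius `R`
therefore serves every smaller radius. -/
theorem view_subset [Fintype V] {v v' : V} {R r : ℕ} (hr : r ≤ R)
    (H : ∀ x, T.graph.dist v x ≤ R → ∃ x', T.seq v' x' = T.seq v x ∧ T.degree x' = T.degree x) :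
    T.view v r ⊆ T.view v' r := by
  intro a ha
  obtain ⟨y, hy, rfl⟩ := mem_view.1 ha
  obtain ⟨x', h1, h2⟩ := H y (hy.trans hr)
  have h3 := congrArg List.length h1
  rw [length_seq, length_seq] at h3
  exact mem_view.2 ⟨x', by omega, by rw [h1, h2]⟩

/-- From the median of `l`, `v`, `v'` both `v` and `v'` are equally far, and the path between them
passes through it. -/
theorem even_dist_of_dist_eq {v v' l : V} (h : T.graph.dist v l = T.graph.dist v' l) :
    Even (T.graph.dist v v') := by
  obtain ⟨m, h1, h2, h3, -⟩ := T.exists_median l v v'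
  unfold Between at *
  rw [T.graph.dist_comm (u := v), T.graph.dist_comm (u := v') (v := l)] at h
  rw [T.graph.dist_comm (u := v) (v := m)] at h3
  exact ⟨T.graph.dist m v, by omega⟩

theorem LeadsTo.length_eq {v l : V} {P : List ℕ} (h : T.LeadsTo v P l) :
    P.length = T.graph.dist v l := by
  obtain ⟨p, hp, rfl⟩ := h
  rw [outPorts, List.length_map, SimpleGraph.Walk.length_darts, T.length_of_isPath hp]

/-- Nodes with equal views are at even distance if leader election is feasible. -/
theorem Solves.even_dist [Fintype V] {alg : LocalAlgorithm} {τ R : ℕ} (hs : T.Solves alg τ)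
    (hτ : τ ≤ R) {v v' : V}
    (H : ∀ x, T.graph.dist v x ≤ R → ∃ x', T.seq v' x' = T.seq v x ∧ T.degree x' = T.degree x)
    (H' : ∀ x, T.graph.dist v' x ≤ R → ∃ x', T.seq v x' = T.seq v' x ∧ T.degree x' = T.degree x) :
    Even (T.graph.dist v v') := by
  obtain ⟨l, hl⟩ := hs
  obtain ⟨P, ⟨r, hr, hP, hlt⟩, hPl⟩ := hl v
  obtain ⟨P', ⟨r', hr', hP', hlt'⟩, hPl'⟩ := hl v'
  have hview : ∀ r ≤ R, T.view v r = T.view v' r := fun r hr =>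
    Finset.Subset.antisymm (view_subset hr H) (view_subset hr H')
  -- Equal views in every round force both nodes to stop in the same round with the same output,
  -- whose length is the distance to the leader.
  have hrr : r = r' := by
    by_contra hne
    rcases lt_or_gt_of_ne hne with h | h
    · have := hlt' r h
      rw [← hview r (hr.trans hτ), hP] at this
      cases this
    · have := hlt r' h
      rw [hview r' (hr'.trans hτ), hP'] at this
      cases this
  subst hrr
  rw [hview r (hr.trans hτ), hP'] at hP
  cases hP
  exact even_dist_of_dist_eq (hPl.length_eq.symm.trans hPl'.length_eq)

/-- The hypothesis makes `xi` finite, and an infimum of a nonempty set in `ℕ∞` is attained. Writing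
it with `+ 2` avoids truncated subtraction and also excludes diameter 1. -/
theorem exists_solves_of_xi [Fintype V] (h : T.xi + 2 ≤ (T.diam : ℕ∞)) :
    ∃ τ, τ + 2 ≤ T.diam ∧ ∃ alg, T.Solves alg τ := by
  have hne : {t : ℕ∞ | ∃ τ : ℕ, t = τ ∧ ∃ alg : LocalAlgorithm, T.Solves alg τ}.Nonempty := by
    rw [Set.nonempty_iff_ne_empty]
    intro he
    rw [xi, he, sInf_empty] at h
    exact absurd h (by simp)
  obtain ⟨τ, h1, h2⟩ := csInf_mem hne
  rw [xi, h1] at h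
  exact ⟨τ, by exact_mod_cast h, h2⟩

theorem exists_between_dist {c z : V} {i : ℕ} (h : i ≤ T.graph.dist c z) :
    ∃ y, T.Between c y z ∧ T.graph.dist c y = i := by
  rw [← length_path] at h
  have h1 := dist_getVert (T.path_isPath c z) h
  refine ⟨_, ?_, h1.1⟩
  unfold Between
  rw [h1.1, h1.2, ← length_path]
  omega

theorem exists_seq_eq_of_prefix {c z : V} {s : List ℕ} (h : s <+: T.seq c z)
    (hs : Even s.length) : ∃ y, T.Between c y z ∧ T.seq c y = s := by
  obtain ⟨i, hi⟩ := hs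
  have hl := h.length_le
  rw [length_seq] at hl
  obtain ⟨y, hy, hd⟩ := exists_between_dist (T := T) (c := c) (z := z) (i := i) (by omega)
  refine ⟨y, hy, ?_⟩
  have h2 := List.prefix_of_prefix_length_le (seq_isPrefix_iff.2 hy) h
    (by rw [length_seq]; omega)
  exact h2.eq_of_length (by rw [length_seq]; omega)

theorem Between.eq_of_dist_eq {c x y z : V} (hx : T.Between c x z) (hy : T.Between c y z)
    (h : T.graph.dist c x = T.graph.dist c y) : x = y := by
  have h5 := List.prefix_of_prefix_length_le (seq_isPrefix_iff.2 hx) (seq_isPrefix_iff.2 hy)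
      (by rw [length_seq, length_seq, h])
  exact seq_injective c (h5.eq_of_length (by rw [length_seq, length_seq, h]))

/-- A sequence to a node has even length, so a prefix ending in an outgoing port is followed by the
incoming port of the same edge. -/
theorem exists_seq_concat {c x w : V} {q : ℕ} (h : T.seq c x ++ [q] <+: T.seq c w) :
    ∃ z r, T.seq c z = T.seq c x ++ [q, r] := by
  obtain ⟨t, ht⟩ := h
  have hl := congrArg List.length ht
  rw [List.length_append, List.length_append, length_seq, length_seq] at hl
  simp only [List.length_singleton] at hl
  cases t with
  | nil =>
    simp only [List.length_nil] at hl
    omega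
  | cons r t =>
    have hp : T.seq c x ++ [q, r] <+: T.seq c w := ⟨t, by rw [← ht]; simp⟩
    obtain ⟨z, -, hz⟩ := exists_seq_eq_of_prefix hp
      (by rw [List.length_append, length_seq]; exact ⟨T.graph.dist c x + 1, by simp; omega⟩)
    exact ⟨z, r, hz⟩

theorem Near.of_between {c c' y z : V} (h : T.graph.Adj c c') (hz : T.Near c c' z)
    (hy : T.Between c y z) : T.Near c c' y := by
  refine (near_or h y).resolve_right fun hy' => ?_
  have h1 := (near_self h).between_right h hy'
  refine (near_self h).not_between hz ?_
  have := T.dist_triangle c c' z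
  have := T.dist_triangle c' y z
  unfold Between at *
  omega

/-! ### Membership in the lists of port sequences -/

theorem mem_sepList [Fintype V] {c c' : V} (h : T.graph.Adj c c') {s : List ℕ} :
    s ∈ T.sepList c c' ↔ ∃ y, T.Near c c' y ∧ T.seq c y = s := by
  have : ∀ y, s(c, c') ∉ (T.path c y).edges ↔ T.Near c c' y := fun y => by
    rw [mem_edges_path_of_near h (near_self h)]
    exact ⟨fun hy => (near_or h y).resolve_right hy, fun hy => hy.not_near⟩
  simp [sepList, this]

theorem mem_shortList [Fintype V] {c : V} {s : List ℕ} :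
    s ∈ T.shortList c ↔ s.length ≤ T.diam - 2 ∧ ∃ y, s <+: T.seq c y := by
  simp only [shortList, Finset.mem_sort, Finset.mem_image, Finset.mem_product, Finset.mem_univ,
    true_and, Finset.mem_range, Prod.exists]
  constructor
  · rintro ⟨y, t, ht, rfl⟩
    exact ⟨(List.length_take_le _ _).trans (by omega), y, List.take_prefix _ _⟩
  · rintro ⟨h, y, hy⟩
    exact ⟨y, s.length, by omega, (List.prefix_iff_eq_take.1 hy).symm⟩

theorem separated_symm {c c' : V} : T.Separated c c' ↔ T.Separated c' c := by
  unfold Separated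
  rw [Sym2.eq_swap]

/-- The side of an edge is closed under going back towards its end, and a bound on length passes to
prefixes. Hence a sequence missing from the other list is not a prefix of any member of that list.
-/
theorem mem_candList_of_prefix [Fintype V] {c c' : V} (h : T.graph.Adj c c') {s t : List ℕ}
    (hs : s ∈ T.candList c c') (ht : t ∈ T.candList c' c) (hp : s <+: t) :
    s ∈ T.candList c' c := by
  unfold candList at *
  rw [separated_symm (c := c')] at *
  split_ifs at *
  · rw [mem_sepList h] at hs
    rw [mem_sepList h.symm] at *
    obtain ⟨y, -, rfl⟩ := hs
    obtain ⟨z, hz, rfl⟩ := ht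
    obtain ⟨x, hx, hxs⟩ := exists_seq_eq_of_prefix hp (by rw [length_seq]; simp)
    exact ⟨x, hz.of_between h.symm hx, hxs⟩
  · rw [mem_shortList] at *
    obtain ⟨h2, z, hz⟩ := ht
    exact ⟨hs.1, z, hp.trans hz⟩

theorem nil_mem_candList [Fintype V] {c c' : V} (h : T.graph.Adj c c') :
    [] ∈ T.candList c c' := by
  unfold candList
  split_ifs
  · exact (mem_sepList h).2 ⟨c, near_self h, seq_self c⟩
  · exact mem_shortList.2 ⟨by simp, c, by simp⟩

theorem exists_isOddAdvice_of_notMem [Fintype V] {c c' : V} (hc : T.IsCentralEdge c c')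
    {s : List ℕ} (hs : s ∈ T.candList c c') (hs' : s ∉ T.candList c' c) :
    ∃ a, T.IsOddAdvice a := by
  classical
  obtain ⟨j, hj⟩ := List.mem_iff_getElem?.1 hs
  let t := (T.candList c' c).getD j []
  -- The default `[]` is also a member of the list, so no separate case is needed when the list is
  -- too short.
  have ht : t ∈ T.candList c' c := by
    rcases lt_or_ge j (T.candList c' c).length with h | h
    · have : t = (T.candList c' c)[j] := List.getD_eq_getElem _ _ h
      rw [this]
      exact List.getElem_mem h
    · have : t = [] := List.getD_eq_default _ _ h
      rw [this]
      exact nil_mem_candList hc.1.symm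
  let P : ℕ → Prop := fun k => k ≤ s.length ∧ k ≤ t.length ∧ s.take k = t.take k
  have h0 : P 0 := ⟨by simp, by simp, by simp⟩
  have hk : IsGreatest {k | P k} (Nat.findGreatest P s.length) :=
    ⟨Nat.findGreatest_spec (Nat.zero_le _) h0, fun k hk => Nat.le_findGreatest hk.1 hk⟩
  generalize Nat.findGreatest P s.length = k at hk
  -- Otherwise `s` would be a prefix of `t`, hence a member of the other list; so the port number
  -- `m` exists.
  have hlt : k < s.length := by
    by_contra hge
    have hks : k = s.length := le_antisymm hk.1.1 (not_lt.1 hge)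
    have h1 := hk.1.2.2
    rw [hks, List.take_length] at h1
    exact hs' (mem_candList_of_prefix hc.1 hs ht (h1 ▸ List.take_prefix _ _))
  exact ⟨⟨T.diam, decide (T.Separated c c'), j, k, s[k], T.port c' c⟩, c, c', s, hc, rfl, by simp,
    hj, hs', hk, by simp [hlt], rfl⟩

/-! ### Separated trees with equal lists -/

/-- Ports leading away on the same side are copied by `E`, and the port of arrival is the last entry
of the common sequence. The one remaining port is that of the central edge, at `y = c`; `hp` handles
it. -/
theorem port_lt_of_seq_eq {c c' y y' : V} (h : T.graph.Adj c c') (hp : T.port c c' = T.port c' c)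
    (E : ∀ y, T.Near c c' y → ∃ y', T.Near c' c y' ∧ T.seq c' y' = T.seq c y)
    (hy : T.Near c c' y) (hyy : T.seq c' y' = T.seq c y) {q : ℕ} (hq : q < T.degree y) :
    q < T.degree y' := by
  rw [lt_degree_iff c' y', hyy]
  rcases (lt_degree_iff c y q).1 hq with ⟨z, r, hz⟩ | hl
  · left
    rcases near_or h z with hzn | hzn
    · obtain ⟨z', -, hz'⟩ := E z hzn
      exact ⟨z', r, hz'.trans hz⟩
    · have hb : T.Between c y z := seq_isPrefix_iff.1 (hz ▸ List.prefix_append _ _)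
      have hd := hy.dist_eq h hzn
      have hyc : c = y := by
        rw [← T.dist_eq_zero]
        unfold Between at hb
        unfold Near at hzn
        omega
      subst hyc
      rw [seq_of_near h hzn] at hz
      simp only [seq_self, List.nil_append, List.cons.injEq] at hz
      exact ⟨c, r, by simp [seq_adj h.symm, ← hz.1, ← hz.2.1, hp]⟩
  · exact Or.inr hl

/-- If the port of `c'` towards `c` occurred at `c` on another edge, the copy of that edge at `c'`
would be the central edge and leave the side. So if the ports differ, each is at least the degree of
the opposite end, and the two degree bounds contradict each other. -/
theorem port_eq_of_seq_eq {c c' : V} (h : T.graph.Adj c c')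
    (E : ∀ y, T.Near c c' y → ∃ y', T.Near c' c y' ∧ T.seq c' y' = T.seq c y)
    (E' : ∀ y, T.Near c' c y → ∃ y', T.Near c c' y' ∧ T.seq c y' = T.seq c' y) :
    T.port c c' = T.port c' c := by
  have key : ∀ {c c'} (_ : T.graph.Adj c c')
      (_ : ∀ y, T.Near c c' y → ∃ y', T.Near c' c y' ∧ T.seq c' y' = T.seq c y) (q : ℕ)
      (_ : q < T.degree c) (_ : q ≠ T.port c c'), q ≠ T.port c' c := by
    rintro c c' h E q hq hne rfl
    obtain ⟨w, hw, hwq⟩ := exists_port hq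
    have hwn : T.Near c c' w := by
      refine (near_or h w).resolve_right fun hw' => hne ?_
      rw [near_iff_head?_seq h, seq_adj hw] at hw'
      simp only [List.head?_cons, Option.some.injEq] at hw'
      rw [← hw', hwq]
    obtain ⟨w', hw', hs⟩ := E w hwn
    refine hw'.not_near ((near_iff_head?_seq h.symm).2 ?_)
    rw [hs, seq_adj hw, hwq]
    rfl
  have h1 := key h E (T.port c' c)
  have h2 := key h.symm E' (T.port c c')
  have h3 := port_lt h
  have h4 := port_lt h.symm
  by_contra hne
  have h5 : T.degree c ≤ T.port c' c := not_lt.1 fun hlt => h1 hlt (Ne.symm hne) rfl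
  have h6 : T.degree c' ≤ T.port c c' := not_lt.1 fun hlt => h2 hlt hne rfl
  omega

/-- Exchanging the two sides preserves addresses and degrees, so the adjacent nodes `c` and `c'`
have equal views at every radius. -/
theorem not_solves_of_seq_eq [Fintype V] {c c' : V} (h : T.graph.Adj c c')
    (E : ∀ y, T.Near c c' y → ∃ y', T.Near c' c y' ∧ T.seq c' y' = T.seq c y)
    (E' : ∀ y, T.Near c' c y → ∃ y', T.Near c c' y' ∧ T.seq c y' = T.seq c' y)
    {alg : LocalAlgorithm} {τ : ℕ} : ¬ T.Solves alg τ := by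
  intro hs
  have key : ∀ {c c'} (_ : T.graph.Adj c c')
      (_ : ∀ y, T.Near c c' y → ∃ y', T.Near c' c y' ∧ T.seq c' y' = T.seq c y)
      (_ : ∀ y, T.Near c' c y → ∃ y', T.Near c c' y' ∧ T.seq c y' = T.seq c' y) (x : V),
      ∃ x', T.seq c' x' = T.seq c x ∧ T.degree x' = T.degree x := by
    intro c c' h E E' x
    have hp := port_eq_of_seq_eq h E E'
    rcases near_or h x with hx | hx
    · obtain ⟨x', hx', hs⟩ := E x hx
      refine ⟨x', hs, ?_⟩
      have h1 := fun q => port_lt_of_seq_eq h hp E hx hs (q := q)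
      have h2 := fun q => port_lt_of_seq_eq h.symm hp.symm E' hx' hs.symm (q := q)
      exact eq_of_forall_lt_iff fun q => ⟨h2 q, h1 q⟩
    · obtain ⟨x', hx', hs⟩ := E' x hx
      refine ⟨x', by rw [seq_of_near h hx, seq_of_near h.symm hx', hs, hp], ?_⟩
      have h1 := fun q => port_lt_of_seq_eq h.symm hp.symm E' hx hs (q := q)
      have h2 := fun q => port_lt_of_seq_eq h hp E hx' hs.symm (q := q)
      exact eq_of_forall_lt_iff fun q => ⟨h2 q, h1 q⟩
  have := hs.even_dist le_rfl (v := c) (v' := c') (fun x _ => key h E E' x)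
    (fun x _ => key h.symm E' E x)
  rw [dist_of_adj h] at this
  exact absurd this (by decide)

/-! ### Trees with equal balls around the ends of the central edge -/

/-- A second neighbour would lie at depth `h + 1` or beyond the central edge, and the latter needs
`x = c`. Consequently the port at a node of depth `h` is always 0. -/
theorem IsCenter.degree_eq_one {h : ℕ} (h0 : 0 < h) {c c' x : V} (H : T.IsCenter h c c')
    (hx : T.Near c c' x) (hd : T.graph.dist c x = h) : T.degree x = 1 := by
  have hne : x ≠ c := by
    rintro rfl
    simp at hd
    omega
  obtain ⟨y, hy, hyd⟩ := exists_adj_dist (T := T) hne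
  have hyb := (between_of_adj hy hyd).symm
  rw [degree, Set.ncard_eq_one]
  refine ⟨y, Set.eq_singleton_iff_unique_mem.2 ⟨hy, fun w hw => ?_⟩⟩
  rw [T.graph.dist_comm (u := x), T.graph.dist_comm (u := y)] at hyd
  rcases T.dist_adj c hw with h1 | h1
  · refine Between.eq_of_dist_eq (between_of_adj hw ?_).symm hyb (by omega)
    rw [T.graph.dist_comm (u := x), T.graph.dist_comm (u := w)]
    exact h1
  · exfalso
    rcases near_or H.adj w with hwn | hwn
    · have := H.depth w hwn
      omega
    · have h2 := hx.dist_eq H.adj hwn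
      rw [dist_of_adj hw] at h2
      omega

theorem port_eq_zero_of_leaf {x y : V} (hx : T.degree x = 1) (h : T.graph.Adj x y) :
    T.port x y = 0 := by
  have := port_lt h
  omega

theorem exists_head_eq_of_not_between {c v x : V} (h : ¬ T.Between v c x) :
    ∃ q, (T.seq c v).head? = some q ∧ (T.seq c x).head? = some q := by
  obtain ⟨m, hv, hx, hvx, -⟩ := T.exists_median c v x
  have hne : c ≠ m := by
    rintro rfl
    exact h hvx
  obtain ⟨a, ha, had⟩ := exists_adj_dist (T := T) hne
  have hb := between_of_adj ha had
  have : ∀ w, T.Between c m w → T.Between c a w := by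
    intro w hw
    have h1 := T.dist_triangle a m w
    have h2 := T.dist_triangle c a w
    clear hv hx hvx
    unfold Between at *
    omega
  exact ⟨_, head?_seq.2 ⟨a, ha, this _ hv, rfl⟩, head?_seq.2 ⟨a, ha, this _ hx, rfl⟩⟩

theorem exists_seq_eq_of_shortList [Fintype V] {h : ℕ} {c c' x : V} (hd : T.diam = 2 * h + 1)
    (S : ∀ s, s ∈ T.shortList c → s ∈ T.shortList c') (hx : T.graph.dist c x < h) :
    ∃ x', T.seq c' x' = T.seq c x := by
  have h1 := S (T.seq c x) (mem_shortList.2 ⟨by rw [length_seq]; omega, x, List.prefix_rfl⟩)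
  obtain ⟨-, z, hz⟩ := mem_shortList.1 h1
  obtain ⟨x', -, hx'⟩ := exists_seq_eq_of_prefix hz (by rw [length_seq]; simp)
  exact ⟨x', hx'⟩

theorem exists_seq_concat_of_shortList [Fintype V] {h : ℕ} {c c' x x' z : V} {q r : ℕ}
    (hd : T.diam = 2 * h + 1)
    (S : ∀ s, s ∈ T.shortList c → s ∈ T.shortList c') (hx : T.graph.dist c x < h)
    (hxx : T.seq c' x' = T.seq c x) (hz : T.seq c z = T.seq c x ++ [q, r]) :
    ∃ z' r', T.seq c' z' = T.seq c' x' ++ [q, r'] := by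
  have h1 := S (T.seq c x ++ [q]) (mem_shortList.2
    ⟨by rw [List.length_append, length_seq, List.length_singleton]; omega, z, by rw [hz]; simp⟩)
  obtain ⟨-, w, hw⟩ := mem_shortList.1 h1
  rw [← hxx] at hw
  exact exists_seq_concat hw

/-- The bound `2h - 1` on length leaves room for one outgoing port at nodes of depth `h - 1`, so
these lists determine degrees up to that depth. -/
theorem degree_eq_of_shortList [Fintype V] {h : ℕ} {c c' x x' : V} (hd : T.diam = 2 * h + 1)
    (S : ∀ s, s ∈ T.shortList c ↔ s ∈ T.shortList c') (hx : T.graph.dist c x < h)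
    (hxx : T.seq c' x' = T.seq c x) : T.degree x' = T.degree x := by
  have key : ∀ {c c' x x'} (_ : ∀ s, s ∈ T.shortList c → s ∈ T.shortList c')
      (_ : T.graph.dist c x < h) (_ : T.seq c' x' = T.seq c x) (q : ℕ) (_ : q < T.degree x),
      q < T.degree x' := by
    intro c c' x x' S hx hxx q hq
    rw [lt_degree_iff c']
    rcases (lt_degree_iff c x q).1 hq with ⟨z, r, hz⟩ | hl
    · exact Or.inl (exists_seq_concat_of_shortList hd S hx hxx hz)
    · exact Or.inr (by rw [hxx, hl])
  have hl := congrArg List.length hxx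
  rw [length_seq, length_seq] at hl
  exact eq_of_forall_lt_iff fun q =>
    ⟨key (fun s => (S s).2) (by omega) hxx.symm q, key (fun s => (S s).1) hx hxx q⟩

/-- The lists reach only to the outgoing port at the parent of `x`. By `hq` the node behind the same
port near `c'` stays on the side of `c'`, so it too is a leaf of depth `h`, and both incoming ports
are 0. -/
theorem IsCenter.exists_leaf_seq_eq [Fintype V] {h : ℕ} (h0 : 0 < h) {c c' x : V}
    (H : T.IsCenter h c c') (S : ∀ s, s ∈ T.shortList c ↔ s ∈ T.shortList c')
    (hx : T.Near c c' x) (hd : T.graph.dist c x = h)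
    (hq : (T.seq c x).head? ≠ some (T.port c' c)) :
    ∃ x', T.seq c' x' = T.seq c x ∧ T.degree x' = T.degree x := by
  have hne : x ≠ c := by
    rintro rfl
    simp at hd
    omega
  obtain ⟨y, hy, hyd⟩ := exists_adj_dist (T := T) hne
  rw [T.graph.dist_comm (u := x), T.graph.dist_comm (u := y)] at hyd
  have hs := seq_of_adj hy.symm hyd
  have hdx := H.degree_eq_one h0 hx hd
  rw [port_eq_zero_of_leaf hdx hy] at hs
  obtain ⟨y', hy'⟩ := exists_seq_eq_of_shortList H.diam (fun s => (S s).1)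
    (show T.graph.dist c y < h by omega)
  obtain ⟨z, r, hz⟩ := exists_seq_concat_of_shortList H.diam (fun s => (S s).1)
    (show T.graph.dist c y < h by omega) hy' hs
  have hhead : (T.seq c' z).head? = (T.seq c x).head? := by
    rw [hz, hy', hs]
    cases T.seq c y <;> rfl
  have hzn : T.Near c' c z := (near_or H.adj.symm z).resolve_right fun hzn =>
    hq (hhead ▸ (near_iff_head?_seq H.adj.symm).1 hzn)
  obtain ⟨hadj, hzd, -, hr⟩ := adj_of_seq_eq_append hz
  have hl := congrArg List.length hy'
  rw [length_seq, length_seq] at hl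
  have hdz := H.symm.degree_eq_one h0 hzn (by omega)
  rw [port_eq_zero_of_leaf hdz hadj.symm] at hr
  exact ⟨z, by rw [hz, hs, hy', hr], hdz.trans hdx.symm⟩

/-- Nodes at distance less than `h` from `c` are covered by the lists. Any other visible node is a
leaf of depth `h` on the side of `v`; being closer to `v` than `2h`, it shares the branch of `v`,
which avoids the bad port. -/
theorem IsCenter.view_leaf_eq [Fintype V] {h : ℕ} (h0 : 0 < h) {c c' v v' : V}
    (H : T.IsCenter h c c') (S : ∀ s, s ∈ T.shortList c ↔ s ∈ T.shortList c')
    (hv : T.Near c c' v) (hd : T.graph.dist c v = h)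
    (hq : (T.seq c v).head? ≠ some (T.port c' c)) (hvv : T.seq c' v' = T.seq c v) (x : V)
    (hx : T.graph.dist v x ≤ T.diam - 2) :
    ∃ x', T.seq v' x' = T.seq v x ∧ T.degree x' = T.degree x := by
  have hdiam := H.diam
  suffices ∃ x', T.seq c' x' = T.seq c x ∧ T.degree x' = T.degree x by
    obtain ⟨x', h1, h2⟩ := this
    exact ⟨x', by rw [← addrSeq_seq c' v' x', ← addrSeq_seq c v x, hvv, h1], h2⟩
  by_cases hlt : T.graph.dist c x < h
  · obtain ⟨x', hx'⟩ := exists_seq_eq_of_shortList H.diam (fun s => (S s).1) hlt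
    exact ⟨x', hx', degree_eq_of_shortList H.diam S hlt hx'⟩
  have hxn : T.Near c c' x := by
    refine (near_or H.adj x).resolve_right fun hxn => ?_
    have h1 := hv.dist_eq H.adj hxn
    unfold Near at hxn
    omega
  have hxd : T.graph.dist c x = h := le_antisymm (H.depth x hxn) (not_lt.1 hlt)
  obtain ⟨q, h1, h2⟩ := exists_head_eq_of_not_between (T := T) (c := c) (v := v) (x := x) (by
    unfold Between
    rw [T.graph.dist_comm (u := v) (v := c)]
    omega)
  exact H.exists_leaf_seq_eq h0 S hxn hxd (by rw [h2, ← h1]; exact hq)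

theorem IsCenter.not_solves_of_leaf [Fintype V] {h : ℕ} (h0 : 0 < h) {c c' v : V}
    (H : T.IsCenter h c c') (S : ∀ s, s ∈ T.shortList c ↔ s ∈ T.shortList c')
    (hv : T.Near c c' v) (hd : T.graph.dist c v = h)
    (hq : (T.seq c v).head? ≠ some (T.port c' c)) {alg : LocalAlgorithm} {τ : ℕ}
    (hτ : τ ≤ T.diam - 2) : ¬ T.Solves alg τ := by
  intro hs
  obtain ⟨v', hvv, -⟩ := H.exists_leaf_seq_eq h0 S hv hd hq
  have hv' : T.Near c' c v' := (near_or H.adj.symm v').resolve_right fun hn =>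
    hq (hvv ▸ (near_iff_head?_seq H.adj.symm).1 hn)
  have hq' : (T.seq c' v').head? ≠ some (T.port c c') := fun hh =>
    hv.not_near ((near_iff_head?_seq H.adj).2 (hvv ▸ hh))
  have hl := congrArg List.length hvv
  rw [length_seq, length_seq] at hl
  have he := hs.even_dist hτ (H.view_leaf_eq h0 S hv hd hq hvv)
    (H.symm.view_leaf_eq h0 (fun s => (S s).symm) hv' (by omega) hq' hvv.symm)
  rw [hv.dist_eq H.adj hv'] at he
  obtain ⟨i, hi⟩ := he
  omega

/-- Two deep leaves in different branches of an end of the central edge prevent leader election if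
the balls around the two ends of the central edge are equal. -/
theorem IsCenter.not_solves_of_leaves [Fintype V] {h : ℕ} (h0 : 0 < h) {c c' v z : V}
    (H : T.IsCenter h c c') (S : ∀ s, s ∈ T.shortList c ↔ s ∈ T.shortList c')
    (hv : T.Near c c' v) (hvd : T.graph.dist c v = h)
    (hz : T.Near c c' z) (hzd : T.graph.dist c z = h)
    (hne : (T.seq c v).head? ≠ (T.seq c z).head?) {alg : LocalAlgorithm} {τ : ℕ}
    (hτ : τ ≤ T.diam - 2) : ¬ T.Solves alg τ := by
  -- The branches of `v` and `z` start with different ports, so at most one of them starts with the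
  -- bad one.
  by_cases hq : (T.seq c v).head? = some (T.port c' c)
  · exact H.not_solves_of_leaf h0 S hz hzd (fun h => hne (hq.trans h.symm)) hτ
  · exact H.not_solves_of_leaf h0 S hv hvd hq hτ

/-! ### Endless paths and gateways -/

theorem exists_isEndless_between {r : ℕ} (hr : 0 < r) {v y : V} (h : r < T.graph.dist v y) :
    ∃ x, T.IsEndless r v x ∧ T.Between v x y := by
  obtain ⟨x, hx, hd⟩ := exists_between_dist (T := T) (c := v) (z := y) h.le
  refine ⟨x, ⟨hd, fun h1 => ?_⟩, hx⟩
  have hxv : x ≠ v := by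
    rintro rfl
    simp at hd
    omega
  have hxy : x ≠ y := by
    rintro rfl
    omega
  obtain ⟨p, hp, hpd⟩ := exists_adj_dist (T := T) hxv
  obtain ⟨a, ha, had⟩ := exists_adj_dist (T := T) hxy
  obtain rfl := port_inj hp ha ((port_eq_zero_of_leaf h1 hp).trans (port_eq_zero_of_leaf h1 ha).symm)
  have := T.dist_triangle v p y
  rw [T.graph.dist_comm (u := x) (v := v), T.graph.dist_comm (u := p) (v := v)] at hpd
  unfold Between at hx
  omega

theorem onAllEndless_iff {r : ℕ} {v g : V} :
    T.OnAllEndless r v g ↔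
      T.graph.dist v g ≤ r ∧ ∀ y, T.IsEndless r v y → T.Between v g y := by
  simp [OnAllEndless, mem_support_path]

theorem exists_isGateway [Finite V] (r : ℕ) (v : V) : ∃ g, T.IsGateway r v g := by
  obtain ⟨g, h1, h2⟩ := Set.exists_max_image {g | T.OnAllEndless r v g} (T.graph.dist v)
    (Set.toFinite _) ⟨v, onAllEndless_iff.2 ⟨by simp, fun y _ => between_left _ _⟩⟩
  exact ⟨g, h1, h2⟩

/-- All nodes common to the endless paths lie on the single path from `v` to `y`, hence in a chain,
and the gateway is furthest along it. -/
theorem IsGateway.between {r : ℕ} {v g x y : V} (hg : T.IsGateway r v g)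
    (hx : T.OnAllEndless r v x) (hy : T.IsEndless r v y) : T.Between v x g := by
  have h1 := (onAllEndless_iff.1 hx).2 y hy
  have h2 := (onAllEndless_iff.1 hg.1).2 y hy
  have h3 := hg.2 x hx
  exact seq_isPrefix_iff.1 (List.prefix_of_prefix_length_le (seq_isPrefix_iff.2 h1)
    (seq_isPrefix_iff.2 h2) (by rw [length_seq, length_seq]; omega))

/-- The end `y` is not a leaf, so its depth is at most `h - 1`. On one side, length `2h - 1` forces
equality in the triangle inequality through `c`; across the central edge, it leaves only the depths
`h` and `h - 1` for `v`. Hence the two values of `ℓ` in the algorithm. -/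
theorem IsCenter.endless_cases {h : ℕ} (h0 : 0 < h) {c c' v y : V} (H : T.IsCenter h c c')
    (hv : T.Near c c' v) (hy : T.IsEndless (T.diam - 2) v y) :
    T.Between v c y ∧ (T.graph.dist c v = h ∨ T.graph.dist c v + 1 = h ∧ T.Near c' c y) := by
  obtain ⟨hd, hdeg⟩ := hy
  have hdiam := H.diam
  have h1 := H.depth v hv
  rcases near_or H.adj y with hyn | hyn
  · have h2 := H.depth y hyn
    have h3 := mt (H.degree_eq_one h0 hyn) hdeg
    have h4 := T.dist_triangle v c y
    unfold Between
    rw [T.graph.dist_comm (u := v) (v := c)] at *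
    omega
  · have h2 := H.depth' y hyn
    have h3 := mt (H.symm.degree_eq_one h0 hyn) hdeg
    have h4 := hv.dist_eq H.adj hyn
    refine ⟨hv.between_left H.adj hyn, ?_⟩
    rcases (show T.graph.dist c v = h ∨ T.graph.dist c v + 1 = h by omega) with h5 | h5
    · exact Or.inl h5
    · exact Or.inr ⟨h5, hyn⟩

/-- In a separated tree all endless paths contain the central edge. -/
theorem Separated.near_of_isEndless [Finite V] {c c' v y : V} (hadj : T.graph.Adj c c')
    (hs : T.Separated c c') (hv : T.Near c c' v)
    (hy : T.IsEndless (T.diam - 2) v y) : T.Near c' c y := by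
  obtain ⟨g, hg⟩ := T.exists_isGateway (T.diam - 2) v
  have h1 := (mem_edges_path_of_near hadj hv).1 (hs v g hg)
  have h2 := hv.between_right hadj h1
  have h3 := (onAllEndless_iff.1 hg.1).2 y hy
  refine (between_iff_near hadj hv).1 (seq_isPrefix_iff.1 ?_)
  exact (seq_isPrefix_iff.2 h2).trans (seq_isPrefix_iff.2 h3)

/-- Some endless path from `v` misses `c'`, so it ends at a node `y` of depth `h - 1` on the side of
`v`, and `v` has depth `h`. For `h > 1`, a child of `y` is the second leaf. For `h = 1` this breaks
down, because then `y = c`. -/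
theorem IsCenter.exists_leaves_of_gateway [Finite V] {h : ℕ} (h0 : 0 < h) {c c' v g : V}
    (H : T.IsCenter h c c') (hv : T.Near c c' v) (hg : T.IsGateway (T.diam - 2) v g)
    (hgn : T.Near c c' g) :
    h = 1 ∨ ∃ x z, T.Near c c' x ∧ T.graph.dist c x = h ∧ T.Near c c' z ∧ T.graph.dist c z = h ∧
      (T.seq c x).head? ≠ (T.seq c z).head? := by
  have hdiam := H.diam
  have hvd := H.depth v hv
  by_cases h1 : h = 1
  · exact Or.inl h1
  right
  by_cases hex : ∃ y, T.IsEndless (T.diam - 2) v y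
  · obtain ⟨y0, hy0⟩ := hex
    have : ¬ T.OnAllEndless (T.diam - 2) v c' := fun hc =>
      hv.not_between hgn (hg.between hc hy0)
    rw [onAllEndless_iff] at this
    push Not at this
    obtain ⟨y, hy, hyb⟩ := this (by
      have : T.graph.dist c' v = T.graph.dist c v + 1 := hv
      rw [T.graph.dist_comm (u := v)]
      omega)
    have hyn : T.Near c c' y := by
      rw [between_iff_near H.adj hv] at hyb
      exact (near_or H.adj y).resolve_right hyb
    obtain ⟨hb, hcase⟩ := H.endless_cases h0 hv hy
    have hcv : T.graph.dist c v = h := hcase.resolve_right fun h => hyn.not_near h.2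
    have hyd : T.graph.dist c y + 1 = h := by
      have h2 := hy.1
      unfold Between at hb
      rw [T.graph.dist_comm (u := v) (v := c)] at hb
      omega
    have hyc : y ≠ c := by
      rintro rfl
      simp at hyd
      omega
    obtain ⟨p, hp, hpd⟩ := exists_adj_dist (T := T) hyc
    have hz : ∃ z, T.graph.Adj y z ∧ T.graph.dist c z = T.graph.dist c y + 1 := by
      by_contra! hno
      refine hy.2 (Set.ncard_eq_one.2 ⟨p, Set.eq_singleton_iff_unique_mem.2 ⟨hp, fun w hw => ?_⟩⟩)
      have h3 := (T.dist_adj c hw).resolve_right (hno w hw)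
      rw [T.graph.dist_comm (u := y), T.graph.dist_comm (u := p)] at hpd
      refine Between.eq_of_dist_eq (c := c) (z := y) (between_of_adj hw ?_).symm
        (between_of_adj hp ?_).symm (by omega)
      · rw [T.graph.dist_comm (u := y), T.graph.dist_comm (u := w), h3]
      · rw [T.graph.dist_comm (u := y), T.graph.dist_comm (u := p), hpd]
    obtain ⟨z, hz, hzd⟩ := hz
    have hzs := seq_of_adj hz hzd
    have hhead : (T.seq c z).head? = (T.seq c y).head? := by
      rw [hzs, List.head?_append_of_ne_nil]
      intro hnil
      exact hyc (seq_injective c (hnil.trans (seq_self c).symm))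
    have hzn : T.Near c c' z := (near_or H.adj z).resolve_right fun hn => by
      rw [near_iff_head?_seq H.adj, hhead, ← near_iff_head?_seq H.adj] at hn
      exact hyn.not_near hn
    -- If `v` and `z` shared a branch, so would `v` and `y`, and a shortcut through its first node
    -- would keep the path from `v` to `y` away from `c`.
    refine ⟨v, z, hv, hcv, hzn, by omega, fun he => ?_⟩
    rw [hhead] at he
    cases hq : (T.seq c v).head? with
    | none =>
      rw [List.head?_eq_none_iff] at hq
      have := congrArg List.length hq
      rw [length_seq] at this
      simp only [List.length_nil] at this
      omega
    | some q =>
      obtain ⟨a, ha, hav, rfl⟩ := head?_seq.1 hq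
      obtain ⟨b, hb', hby, hab⟩ := head?_seq.1 (he.symm.trans hq)
      obtain rfl := port_inj hb' ha hab
      have h4 := T.dist_triangle v b y
      have h5 := dist_of_adj hb'
      unfold Between at *
      rw [T.graph.dist_comm (u := v) (v := c)] at hb
      rw [T.graph.dist_comm (u := v) (v := b)] at h4
      omega
  · exfalso
    push Not at hex
    -- Without endless paths every visible node is eligible as gateway. The deepest node beyond the
    -- central edge is visible and further away than anything on the side of `v`.
    obtain ⟨z, hzn, hzd⟩ := H.deep'
    have h2 := hv.dist_eq H.adj hzn
    have h3 : T.graph.dist v z ≤ T.diam - 2 := not_lt.1 fun hlt => by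
      obtain ⟨x, hx, -⟩ := exists_isEndless_between (by omega) hlt
      exact hex x hx
    have h4 := hg.2 z (onAllEndless_iff.2 ⟨h3, fun y hy => absurd hy (hex y)⟩)
    have h5 := T.dist_triangle v c g
    have h6 := H.depth g hgn
    rw [T.graph.dist_comm (u := v) (v := c)] at h5
    omega

theorem exists_adj_ne_ne {c a : V} (h : 3 ≤ T.degree c) :
    ∃ x z, T.graph.Adj c x ∧ T.graph.Adj c z ∧ x ≠ a ∧ z ≠ a ∧ x ≠ z := by
  have h2 : 1 < (T.graph.neighborSet c \ {a}).ncard := by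
    have := Set.pred_ncard_le_ncard_sdiff_singleton (T.graph.neighborSet c) a
    have h3 : 3 ≤ (T.graph.neighborSet c).ncard := h
    omega
  obtain ⟨x, hx, z, hz, hxz⟩ := (Set.one_lt_ncard (Set.finite_of_ncard_pos (by omega))).1 h2
  exact ⟨x, z, hx.1, hz.1, hx.2, hz.2, hxz⟩

theorem near_of_adj {c c' y : V} (h : T.graph.Adj c c') (hy : T.graph.Adj c y) (hne : y ≠ c') :
    T.Near c c' y := by
  refine (near_or h y).resolve_right fun hn => hne ?_
  rw [near_iff_head?_seq h, seq_adj hy] at hn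
  exact port_inj hy h (by simpa using hn)

/-- For `h = 1` the tree is a double star: every node is adjacent to exactly one of `c` and `c'`. -/
theorem IsCenter.card_eq [Fintype V] {c c' : V} (H : T.IsCenter 1 c c') :
    Fintype.card V = T.degree c + T.degree c' := by
  have key : ∀ {a b : V} (_ : T.IsCenter 1 a b) (y) (_ : T.Near a b y),
      T.graph.Adj a y ∨ T.graph.Adj b y := by
    intro a b H y hy
    have h1 := H.depth y hy
    rcases Nat.le_one_iff_eq_zero_or_eq_one.1 h1 with h2 | h2
    · rw [T.dist_eq_zero] at h2
      exact Or.inr (h2 ▸ H.adj.symm)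
    · exact Or.inl (SimpleGraph.dist_eq_one_iff_adj.1 h2)
  have hu : T.graph.neighborSet c ∪ T.graph.neighborSet c' = Set.univ := by
    refine Set.eq_univ_of_forall fun y => ?_
    rcases near_or H.adj y with hy | hy
    · exact key H y hy
    · exact (key H.symm y hy).symm
  have hdis : Disjoint (T.graph.neighborSet c) (T.graph.neighborSet c') := by
    rw [Set.disjoint_left]
    intro y h1 h2
    have h3 := dist_of_adj (T := T) h1
    have h4 := dist_of_adj (T := T) h2
    rcases near_or H.adj y with hy | hy <;> unfold Near at hy <;> omega
  rw [degree, degree, ← Set.ncard_union_eq hdis, hu, Set.ncard_univ, Nat.card_eq_fintype_card]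

theorem IsCenter.two_le_degree {h : ℕ} (h0 : 0 < h) {c c' : V} (H : T.IsCenter h c c') :
    2 ≤ T.degree c := by
  obtain ⟨y, hy, hyd⟩ := H.deep
  have hne : c ≠ y := by
    rintro rfl
    simp at hyd
    omega
  obtain ⟨z, hz, hzd⟩ := exists_adj_dist (T := T) hne
  have hzc : z ≠ c' := by
    rintro rfl
    unfold Near at hy
    omega
  have h1 := mt (port_inj hz H.adj) hzc
  have h2 := port_lt hz
  have h3 := port_lt H.adj
  omega

theorem IsCenter.degree_eq_of_shortList [Fintype V] {h : ℕ} (h0 : 0 < h) {c c' : V}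
    (H : T.IsCenter h c c') (S : ∀ s, s ∈ T.shortList c ↔ s ∈ T.shortList c') :
    T.degree c' = T.degree c :=
  T.degree_eq_of_shortList H.diam S (by simpa using h0) (by simp)

theorem IsCenter.exists_leaves_of_degree {c c' : V} (H : T.IsCenter 1 c c')
    (hdeg : 3 ≤ T.degree c) :
    ∃ x z, T.Near c c' x ∧ T.graph.dist c x = 1 ∧ T.Near c c' z ∧ T.graph.dist c z = 1 ∧
      (T.seq c x).head? ≠ (T.seq c z).head? := by
  obtain ⟨x, z, hx, hz, hxc, hzc, hne⟩ := exists_adj_ne_ne (a := c') hdeg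
  refine ⟨x, z, near_of_adj H.adj hx hxc, dist_of_adj hx, near_of_adj H.adj hz hzc,
    dist_of_adj hz, fun he => hne ?_⟩
  rw [seq_adj hx, seq_adj hz] at he
  exact port_inj hx hz (by simpa using he)

/-! ### Existence of an advice -/

theorem candList_of_separated [Fintype V] {c c' : V} (h : T.Separated c c') :
    T.candList c c' = T.sepList c c' := if_pos h

theorem candList_of_not_separated [Fintype V] {c c' : V} (h : ¬ T.Separated c c') :
    T.candList c c' = T.shortList c := if_neg h

theorem IsCenter.not_solves_of_gateway [Fintype V] {h : ℕ} (h0 : 0 < h) {c c' v g : V}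
    (H : T.IsCenter h c c') (hcard : Fintype.card V ≠ 4)
    (S : ∀ s, s ∈ T.shortList c ↔ s ∈ T.shortList c')
    (hv : T.Near c c' v) (hg : T.IsGateway (T.diam - 2) v g) (hgn : T.Near c c' g)
    {alg : LocalAlgorithm} {τ : ℕ} (hτ : τ ≤ T.diam - 2) : ¬ T.Solves alg τ := by
  have key : ∃ x z, T.Near c c' x ∧ T.graph.dist c x = h ∧ T.Near c c' z ∧
      T.graph.dist c z = h ∧ (T.seq c x).head? ≠ (T.seq c z).head? := by
    rcases H.exists_leaves_of_gateway h0 hv hg hgn with h1 | h1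
    -- Here `n` is the sum of two equal degrees, each at least 2; since `n ≠ 4`, both are at least
    -- 3, which gives two leaves at `c`.
    · subst h1
      apply H.exists_leaves_of_degree
      have h2 := H.card_eq
      have h3 := H.degree_eq_of_shortList h0 S
      have h4 := H.two_le_degree h0
      omega
    · exact h1
  obtain ⟨x, z, hx, hxd, hz, hzd, hne⟩ := key
  exact H.not_solves_of_leaves h0 S hx hxd hz hzd hne hτ

theorem exists_isOddAdvice [Fintype V] (hodd : Odd T.diam) (hxi : T.xi + 2 ≤ (T.diam : ℕ∞))
    (hcard : Fintype.card V ≠ 4) : ∃ a, T.IsOddAdvice a := by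
  obtain ⟨τ, hτ, alg, hs⟩ := exists_solves_of_xi hxi
  obtain ⟨h, hd⟩ := hodd
  have h0 : 0 < h := by omega
  have hτ' : τ ≤ T.diam - 2 := by omega
  obtain ⟨c, c', H⟩ := exists_isCenter hd
  by_contra hno
  have S : ∀ s, s ∈ T.candList c c' ↔ s ∈ T.candList c' c := by
    intro s
    constructor
    · intro h1
      by_contra h2
      exact hno (exists_isOddAdvice_of_notMem H.isCentralEdge h1 h2)
    · intro h1
      by_contra h2
      exact hno (exists_isOddAdvice_of_notMem H.symm.isCentralEdge h1 h2)
  by_cases hsep : T.Separated c c'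
  · rw [candList_of_separated hsep, candList_of_separated (separated_symm.1 hsep)] at S
    refine not_solves_of_seq_eq H.adj (fun y hy => ?_) (fun y hy => ?_) hs
    · exact (mem_sepList H.adj.symm).1 ((S _).1 ((mem_sepList H.adj).2 ⟨y, hy, rfl⟩))
    · exact (mem_sepList H.adj).1 ((S _).2 ((mem_sepList H.adj.symm).2 ⟨y, hy, rfl⟩))
  · rw [candList_of_not_separated hsep,
      candList_of_not_separated (mt separated_symm.2 hsep)] at S
    unfold Separated at hsep
    push Not at hsep
    obtain ⟨v, g, hg, he⟩ := hsep
    rcases near_or H.adj v with hv | hv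
    · rw [mem_edges_path_of_near H.adj hv] at he
      exact H.not_solves_of_gateway h0 hcard S hv hg ((near_or H.adj g).resolve_right he) hτ' hs
    · rw [Sym2.eq_swap, mem_edges_path_of_near H.adj.symm hv] at he
      exact H.symm.not_solves_of_gateway h0 hcard (fun s => (S s).symm) hv hg
        ((near_or H.adj.symm g).resolve_right he) hτ' hs

/-! ### Computations in views -/

theorem mem_nodes_view [Fintype V] {v : V} {r : ℕ} {b : List ℕ} :
    b ∈ (T.view v r).nodes ↔ ∃ y, T.graph.dist v y ≤ r ∧ T.seq v y = b := by
  simp [View.nodes, mem_view]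

theorem seq_mem_nodes_view [Fintype V] {v y : V} {r : ℕ} :
    T.seq v y ∈ (T.view v r).nodes ↔ T.graph.dist v y ≤ r := by
  rw [mem_nodes_view]
  constructor
  · rintro ⟨z, hz, he⟩
    exact seq_injective v he ▸ hz
  · exact fun h => ⟨y, h, rfl⟩

theorem mem_endless_view [Fintype V] {v : V} {r : ℕ} {a : List ℕ} :
    a ∈ (T.view v r).endless r ↔ ∃ y, T.IsEndless r v y ∧ T.seq v y = a := by
  rw [View.endless, Finset.mem_filter, mem_nodes_view]
  constructor
  · rintro ⟨⟨y, hy, rfl⟩, hd, hdeg⟩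
    rw [addrDist_nil_seq] at hd
    exact ⟨y, ⟨hd, fun h1 => hdeg (mem_view.2 ⟨y, hy, by rw [h1]⟩)⟩, rfl⟩
  · rintro ⟨y, ⟨hd, hdeg⟩, rfl⟩
    refine ⟨⟨y, hd.le, rfl⟩, by rw [addrDist_nil_seq, hd], fun hm => hdeg ?_⟩
    obtain ⟨z, -, hz⟩ := mem_view.1 hm
    rw [Prod.mk.injEq] at hz
    exact seq_injective v hz.1 ▸ hz.2

theorem onAllEndless_view_iff [Fintype V] {v g : V} {r : ℕ} :
    T.OnAllEndless r v g ↔ T.seq v g ∈ (T.view v r).nodes ∧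
      ∀ a ∈ (T.view v r).endless r, T.seq v g <+: a := by
  rw [onAllEndless_iff, seq_mem_nodes_view]
  refine and_congr_right fun _ => ⟨fun h a ha => ?_, fun h y hy => ?_⟩
  · obtain ⟨y, hy, rfl⟩ := mem_endless_view.1 ha
    exact seq_isPrefix_iff.2 (h y hy)
  · exact seq_isPrefix_iff.1 (h _ (mem_endless_view.2 ⟨y, hy, rfl⟩))

theorem isGateway_view_iff [Fintype V] {v g : V} {r : ℕ} :
    (T.view v r).IsGateway r (T.seq v g) ↔ T.IsGateway r v g := by
  rw [View.IsGateway, IsGateway, onAllEndless_view_iff, and_assoc]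
  refine and_congr_right fun _ => and_congr_right fun _ => ⟨fun h x hx => ?_, fun h b hb hb' => ?_⟩
  · rw [onAllEndless_view_iff] at hx
    have := h _ hx.1 hx.2
    rwa [addrDist_nil_seq, addrDist_nil_seq] at this
  · obtain ⟨x, -, rfl⟩ := mem_nodes_view.1 hb
    rw [addrDist_nil_seq, addrDist_nil_seq]
    exact h x (onAllEndless_view_iff.2 ⟨hb, hb'⟩)

/-- Uniqueness of the gateway is never needed: later arguments work for whichever gateway is picked.
-/
theorem exists_epsilon_isGateway [Fintype V] (v : V) (r : ℕ) :
    ∃ g, T.IsGateway r v g ∧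
      Classical.epsilon (fun g => (T.view v r).IsGateway r g) = T.seq v g := by
  obtain ⟨g, hg⟩ := T.exists_isGateway r v
  have h1 := Classical.epsilon_spec
    (p := fun g => (T.view v r).IsGateway r g) ⟨_, isGateway_view_iff.2 hg⟩
  obtain ⟨x, -, hx⟩ := mem_nodes_view.1 h1.1
  rw [← hx] at h1
  exact ⟨x, isGateway_view_iff.1 h1, hx.symm⟩

/-! ### Candidates and lists computed from views -/

theorem IsCenter.diam_sub_one {h : ℕ} {c c' : V} (H : T.IsCenter h c c') :
    (T.diam - 1) / 2 = h := by
  have := H.diam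
  omega

theorem IsCenter.isMiddle {h : ℕ} {c c' x y : V} (H : T.IsCenter h c c') (v : V)
    (hx : T.Near c c' x) (hxy : T.graph.dist x y = 2 * h + 1) :
    View.IsMiddle h (T.seq v x) (T.seq v y) (T.seq v c) (T.seq v c') := by
  have hy : T.Near c' c y := by
    refine (near_or H.adj y).resolve_left fun hy => ?_
    have h1 := H.depth x hx
    have h2 := H.depth y hy
    have h3 := T.dist_triangle x c y
    rw [T.graph.dist_comm (u := x) (v := c)] at h3
    omega
  have h0 := hx.dist_eq H.adj hy
  have h1 := H.depth x hx
  have h2 := H.depth' y hy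
  unfold View.IsMiddle
  rw [addrDist_seq, addrDist_seq, addrDist_seq, dist_of_adj H.adj, T.graph.dist_comm (u := x)]
  exact ⟨by omega, rfl, by omega⟩

theorem IsCenter.candidate_of_no_endless [Fintype V] {h : ℕ} (h0 : 0 < h) {c c' v : V}
    (H : T.IsCenter h c c') (hv : T.Near c c' v) (hno : ∀ y, ¬ T.IsEndless (T.diam - 2) v y) :
    (T.view v (T.diam - 2)).candidate T.diam = (T.seq v c, T.seq v c') := by
  have hdiam := H.diam
  -- A node out of sight would lie behind the end of an endless path; so the view is the whole tree.
  have hall : ∀ y, T.seq v y ∈ (T.view v (T.diam - 2)).nodes := fun y => by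
    rw [seq_mem_nodes_view]
    refine not_lt.1 fun hlt => ?_
    obtain ⟨x, hx, -⟩ := exists_isEndless_between (by omega) hlt
    exact hno x hx
  have he : (T.view v (T.diam - 2)).endless (T.diam - 2) = ∅ := by
    refine Finset.eq_empty_of_forall_notMem fun a ha => ?_
    obtain ⟨y, hy, -⟩ := mem_endless_view.1 ha
    exact hno y hy
  rw [View.candidate, if_pos he]
  have hvc : T.graph.dist v c' = T.graph.dist v c + 1 := by
    rw [T.graph.dist_comm (u := v), T.graph.dist_comm (u := v)]
    exact hv
  have hspec := Classical.epsilon_spec (p := fun e : List ℕ × List ℕ =>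
    (T.view v (T.diam - 2)).IsCentral T.diam e.1 e.2 ∧ addrDist [] e.1 < addrDist [] e.2)
    ⟨(T.seq v c, T.seq v c'), ⟨hall c, hall c', fun a ha b hb hab => by
      obtain ⟨x, -, rfl⟩ := mem_nodes_view.1 ha
      obtain ⟨y, -, rfl⟩ := mem_nodes_view.1 hb
      rw [addrDist_seq, hdiam] at hab
      rw [H.diam_sub_one]
      rcases near_or H.adj x with hx | hx
      · exact Or.inl (H.isMiddle v hx hab)
      · exact Or.inr (H.symm.isMiddle v hx hab)⟩, by
      rw [addrDist_nil_seq, addrDist_nil_seq]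
      omega⟩
  generalize Classical.epsilon (fun e : List ℕ × List ℕ =>
    (T.view v (T.diam - 2)).IsCentral T.diam e.1 e.2 ∧ addrDist [] e.1 < addrDist [] e.2) = e at *
  obtain ⟨⟨ha, hb, hc⟩, hlt⟩ := hspec
  obtain ⟨a, -, ha⟩ := mem_nodes_view.1 ha
  obtain ⟨b, -, hb⟩ := mem_nodes_view.1 hb
  obtain ⟨x, hx, hxd⟩ := H.deep
  obtain ⟨y, hy, hyd⟩ := H.deep'
  have hxy := hx.dist_eq H.adj hy
  have hxy' : T.graph.dist x y = 2 * h + 1 := by omega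
  have hmid := hc _ (hall x) _ (hall y) (by rw [addrDist_seq]; omega)
  simp only [← ha, ← hb, View.IsMiddle, H.diam_sub_one, addrDist_seq] at hmid
  rw [← ha, ← hb, addrDist_nil_seq, addrDist_nil_seq] at hlt
  rcases hmid with ⟨h1, h2, h3⟩ | ⟨h1, h2, h3⟩
  · obtain ⟨rfl, rfl⟩ := H.middle hx hxy' h1 h3 h2
    exact Prod.ext ha.symm hb.symm
  · obtain ⟨rfl, rfl⟩ := H.middle hx hxy' h1 h3 h2
    omega

theorem IsCenter.onAllEndless [Fintype V] {h : ℕ} (h0 : 0 < h) {c c' v : V}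
    (H : T.IsCenter h c c') (hv : T.Near c c' v) : T.OnAllEndless (T.diam - 2) v c := by
  have := H.diam
  have := H.depth v hv
  refine onAllEndless_iff.2 ⟨?_, fun y hy => (H.endless_cases h0 hv hy).1⟩
  rw [T.graph.dist_comm (u := v)]
  omega

/-- The gateway lies at `c` or behind it. From depth `h`, no visible node is further from `c` than
`v`, so none is further from `g`. From depth `h - 1`, all endless paths cross the central edge, so
`g` lies beyond it, and a leaf of depth `h` on the side of `v` is visible and further away. -/
theorem IsCenter.exists_farther_iff [Fintype V] {h : ℕ} (h0 : 0 < h) {c c' v g y : V}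
    (H : T.IsCenter h c c') (hv : T.Near c c' v) (hg : T.IsGateway (T.diam - 2) v g)
    (hy : T.IsEndless (T.diam - 2) v y) :
    (∃ w ∈ (T.view v (T.diam - 2)).nodes,
      addrDist w (T.seq v g) > addrDist [] (T.seq v g)) ↔ T.graph.dist c v + 1 = h := by
  have hdiam := H.diam
  constructor
  · rintro ⟨w, hw, hlt⟩
    obtain ⟨x, hx, rfl⟩ := mem_nodes_view.1 hw
    rw [addrDist_seq, addrDist_nil_seq] at hlt
    rcases (H.endless_cases h0 hv hy).2 with h1 | h1
    · exfalso
      have h2 := hg.between (H.onAllEndless h0 hv) hy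
      have h3 := T.dist_triangle x c g
      unfold Between at h2
      rw [T.graph.dist_comm (u := v) (v := c)] at h2
      rw [T.graph.dist_comm (u := x) (v := c)] at h3
      rcases near_or H.adj x with hxn | hxn
      · have := H.depth x hxn
        omega
      · have := hv.dist_eq H.adj hxn
        unfold Near at hxn
        omega
    · exact h1.1
  · intro h1
    have hall : T.OnAllEndless (T.diam - 2) v c' := by
      refine onAllEndless_iff.2 ⟨?_, fun z hz => ?_⟩
      · rw [T.graph.dist_comm (u := v), hv]
        omega
      · rcases (H.endless_cases h0 hv hz).2 with h2 | h2
        · omega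
        · exact hv.between_right H.adj h2.2
    have hgn := (between_iff_near H.adj hv).1 (hg.between hall hy)
    obtain ⟨w, hw, hwd⟩ := H.deep
    refine ⟨T.seq v w, seq_mem_nodes_view.2 ?_, ?_⟩
    · have := T.dist_triangle v c w
      rw [T.graph.dist_comm (u := v) (v := c)] at this
      omega
    · rw [addrDist_seq, addrDist_nil_seq, hv.dist_eq H.adj hgn, hw.dist_eq H.adj hgn]
      omega

theorem IsCenter.candOfGateway_eq [Fintype V] {h : ℕ} (h0 : 0 < h) {c c' v y : V}
    (H : T.IsCenter h c c') (hv : T.Near c c' v) (hy : T.IsEndless (T.diam - 2) v y) :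
    (T.view v (T.diam - 2)).candOfGateway T.diam = T.seq v c := by
  obtain ⟨g, hg, he⟩ := T.exists_epsilon_isGateway v (T.diam - 2)
  have hc := H.onAllEndless h0 hv
  have hcg := hg.between hc hy
  have hl : (if T.graph.dist c v + 1 = h then h - 1 else h) = T.graph.dist v c := by
    rw [T.graph.dist_comm (u := v)]
    have := (H.endless_cases h0 hv hy).2
    split_ifs <;> omega
  rw [View.candOfGateway]
  simp only [he, H.exists_farther_iff h0 hv hg hy, H.diam_sub_one, hl]
  have hspec := Classical.epsilon_spec (p := fun b : List ℕ =>
    b ∈ (T.view v (T.diam - 2)).nodes ∧ b <+: T.seq v g ∧ addrDist [] b = T.graph.dist v c)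
    ⟨T.seq v c, (onAllEndless_view_iff.1 hc).1, seq_isPrefix_iff.2 hcg, addrDist_nil_seq _ _⟩
  obtain ⟨h1, h2, h3⟩ := hspec
  obtain ⟨x, -, hx⟩ := mem_nodes_view.1 h1
  rw [← hx, addrDist_nil_seq] at h3
  rw [← hx, seq_isPrefix_iff] at h2
  rw [← hx, h2.eq_of_dist_eq hcg h3]

theorem IsCenter.nextOnEndless_eq [Fintype V] {h : ℕ} {c c' v y : V}
    (H : T.IsCenter h c c') (hv : T.Near c c' v) (hy : T.IsEndless (T.diam - 2) v y)
    (hs : T.Separated c c') :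
    (T.view v (T.diam - 2)).nextOnEndless T.diam (T.seq v c) = T.seq v c' := by
  have hc' : T.OnAllEndless (T.diam - 2) v c' := by
    have hb : ∀ z, T.IsEndless (T.diam - 2) v z → T.Between v c' z := fun z hz =>
      hv.between_right H.adj (hs.near_of_isEndless H.adj hv hz)
    refine onAllEndless_iff.2 ⟨?_, hb⟩
    have := hb y hy
    have := hy.1
    unfold Between at *
    omega
  have hcc : T.Between v c c' := hv.between_left H.adj (near_self H.adj.symm)
  have hspec := Classical.epsilon_spec (p := fun b : List ℕ =>
    b ∈ (T.view v (T.diam - 2)).nodes ∧ addrDist (T.seq v c) b = 1 ∧ T.seq v c <+: b ∧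
    ∀ a ∈ (T.view v (T.diam - 2)).endless (T.diam - 2), b <+: a)
    ⟨T.seq v c', (onAllEndless_view_iff.1 hc').1, by rw [addrDist_seq, dist_of_adj H.adj],
      seq_isPrefix_iff.2 hcc, (onAllEndless_view_iff.1 hc').2⟩
  rw [View.nextOnEndless]
  obtain ⟨h1, h2, h3, h4⟩ := hspec
  obtain ⟨x, -, hx⟩ := mem_nodes_view.1 h1
  have h5 := h4 _ (mem_endless_view.2 ⟨y, hy, rfl⟩)
  rw [← hx, addrDist_seq] at h2
  rw [← hx, seq_isPrefix_iff] at h3 h5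
  have h6 := (onAllEndless_iff.1 hc').2 y hy
  have h7 := dist_of_adj H.adj
  rw [← hx, h5.eq_of_dist_eq h6 (by unfold Between at h3 hcc; omega)]

theorem IsCenter.candidate_fst [Fintype V] {h : ℕ} (h0 : 0 < h) {c c' v : V}
    (H : T.IsCenter h c c') (hv : T.Near c c' v) :
    ((T.view v (T.diam - 2)).candidate T.diam).1 = T.seq v c := by
  by_cases hex : ∃ y, T.IsEndless (T.diam - 2) v y
  · obtain ⟨y, hy⟩ := hex
    rw [View.candidate, if_neg (Finset.ne_empty_of_mem (mem_endless_view.2 ⟨y, hy, rfl⟩))]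
    exact H.candOfGateway_eq h0 hv hy
  · rw [H.candidate_of_no_endless h0 hv (not_exists.1 hex)]

theorem IsCenter.candidate_snd [Fintype V] {h : ℕ} (h0 : 0 < h) {c c' v : V}
    (H : T.IsCenter h c c') (hv : T.Near c c' v) (hs : T.Separated c c') :
    ((T.view v (T.diam - 2)).candidate T.diam).2 = T.seq v c' := by
  by_cases hex : ∃ y, T.IsEndless (T.diam - 2) v y
  · obtain ⟨y, hy⟩ := hex
    rw [View.candidate, if_neg (Finset.ne_empty_of_mem (mem_endless_view.2 ⟨y, hy, rfl⟩))]
    rw [H.candOfGateway_eq h0 hv hy]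
    exact H.nextOnEndless_eq hv hy hs
  · rw [H.candidate_of_no_endless h0 hv (not_exists.1 hex)]

/-- In a separated tree a node sees its whole side: a path to an invisible node starts with an
endless path, which already crosses the central edge. -/
theorem IsCenter.sepList_view [Fintype V] {h : ℕ} (h0 : 0 < h) {c c' v : V}
    (H : T.IsCenter h c c') (hv : T.Near c c' v) (hs : T.Separated c c') :
    (T.view v (T.diam - 2)).sepList (T.seq v c) (T.seq v c') = T.sepList c c' := by
  have hdiam := H.diam
  have hball : ∀ y, T.Near c c' y → T.graph.dist v y ≤ T.diam - 2 := fun y hy => by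
    refine not_lt.1 fun hlt => ?_
    obtain ⟨x, hx, hxy⟩ := exists_isEndless_between (by omega) hlt
    have h1 := hv.between_right H.adj (hs.near_of_isEndless H.adj hv hx)
    refine hv.not_between hy (seq_isPrefix_iff.1 ?_)
    exact (seq_isPrefix_iff.2 h1).trans (seq_isPrefix_iff.2 hxy)
  rw [View.sepList, sepList]
  congr 1
  ext s
  have hr := mem_sepList (T := T) H.adj (s := s)
  rw [sepList, Finset.mem_sort] at hr
  rw [hr, Finset.mem_image]
  constructor
  · rintro ⟨b, hb, rfl⟩
    rw [Finset.mem_filter] at hb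
    obtain ⟨y, -, rfl⟩ := mem_nodes_view.1 hb.1
    refine ⟨y, (near_or H.adj y).resolve_right fun hn => hb.2 ?_, (addrSeq_seq _ _ _).symm⟩
    exact seq_isPrefix_iff.2 (hv.between_right H.adj hn)
  · rintro ⟨y, hy, rfl⟩
    refine ⟨T.seq v y, Finset.mem_filter.2 ⟨seq_mem_nodes_view.2 (hball y hy), fun hp => ?_⟩,
      addrSeq_seq _ _ _⟩
    exact hv.not_between hy (seq_isPrefix_iff.1 hp)

/-- Only nodes at distance at most `h - 1` from `c` matter, and these are within `2h - 1` of `v`. A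
final outgoing port is read off the degree, leaving out the port of arrival. -/
theorem IsCenter.shortList_view [Fintype V] {h : ℕ} {c c' v : V}
    (H : T.IsCenter h c c') (hv : T.Near c c' v) :
    (T.view v (T.diam - 2)).shortList T.diam (T.seq v c) = T.shortList c := by
  have hdiam := H.diam
  have hvd := H.depth v hv
  rw [View.shortList, shortList]
  congr 1
  ext s
  have hr := mem_shortList (T := T) (c := c) (s := s)
  rw [shortList, Finset.mem_sort] at hr
  rw [hr, Finset.mem_filter, and_comm]
  refine and_congr_right fun hlen => ?_
  simp only [Finset.mem_biUnion, Finset.mem_insert, Finset.mem_image, Finset.mem_filter,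
    Finset.mem_range]
  constructor
  · rintro ⟨b, hb, hs⟩
    obtain ⟨y, -, rfl⟩ := mem_view.1 hb
    simp only [addrSeq_seq] at hs
    rcases hs with rfl | ⟨q, ⟨hq, hne⟩, rfl⟩
    · exact ⟨y, List.prefix_rfl⟩
    · obtain ⟨z, r, hz⟩ := ((lt_degree_iff c y q).1 hq).resolve_right hne
      exact ⟨z, by rw [hz]; simp⟩
  · rintro ⟨y, hy⟩
    have hnode : ∀ x, 2 * T.graph.dist c x ≤ T.diam - 2 →
        (T.seq v x, T.degree x) ∈ T.view v (T.diam - 2) := fun x hx => by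
      refine mem_view.2 ⟨x, ?_, rfl⟩
      have := T.dist_triangle v c x
      rw [T.graph.dist_comm (u := v) (v := c)] at this
      omega
    rcases Nat.even_or_odd s.length with he | ho
    · obtain ⟨x, -, rfl⟩ := exists_seq_eq_of_prefix hy he
      rw [length_seq] at hlen
      exact ⟨_, hnode x hlen, Or.inl (addrSeq_seq _ _ _).symm⟩
    · have hne : s ≠ [] := by
        rintro rfl
        exact absurd ho (by decide)
      obtain ⟨t, q, rfl⟩ : ∃ t q, s = t ++ [q] :=
        ⟨_, _, (List.dropLast_append_getLast hne).symm⟩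
      rw [List.length_append, List.length_singleton] at ho hlen
      obtain ⟨x, -, rfl⟩ := exists_seq_eq_of_prefix ((List.prefix_append t [q]).trans hy)
        (by rwa [Nat.odd_add_one, Nat.not_odd_iff_even] at ho)
      obtain ⟨z, r, hz⟩ := exists_seq_concat hy
      rw [length_seq] at hlen
      refine ⟨_, hnode x (by omega), Or.inr ⟨q, ⟨?_, ?_⟩, ?_⟩⟩
      · exact (lt_degree_iff c x q).2 (Or.inl ⟨z, r, hz⟩)
      · rw [addrSeq_seq]
        exact getLast?_ne_of_seq_eq_append hz
      · rw [addrSeq_seq]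

/-! ### Correctness of OddElect -/

open Classical in
theorem IsCenter.oddElectOutput_eq [Fintype V] {h : ℕ} (h0 : 0 < h) {c c' v : V}
    (H : T.IsCenter h c c') (hv : T.Near c c' v) {a : OddAdvice} (hd : a.diam = T.diam)
    (hs : a.sep = true ↔ T.Separated c c') :
    oddElectOutput a (T.view v (T.diam - 2)) =
      if ∃ s, (T.candList c c')[a.j]? = some s ∧ s[a.k]? = some a.m then outgoing (T.seq v c)
      else outgoing (T.seq v c) ++ [a.p] := by
  have hL : (if a.sep = true then
      (T.view v (T.diam - 2)).sepList ((T.view v (T.diam - 2)).candidate T.diam).1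
        ((T.view v (T.diam - 2)).candidate T.diam).2
      else (T.view v (T.diam - 2)).shortList T.diam
        ((T.view v (T.diam - 2)).candidate T.diam).1) = T.candList c c' := by
    by_cases hsep : T.Separated c c'
    · rw [if_pos (hs.2 hsep), candList_of_separated hsep, H.candidate_fst h0 hv,
        H.candidate_snd h0 hv hsep, H.sepList_view h0 hv hsep]
    · rw [if_neg (mt hs.1 hsep), candList_of_not_separated hsep, H.candidate_fst h0 hv,
        H.shortList_view hv]
  simp only [oddElectOutput, hd, hL]
  rw [H.candidate_fst h0 hv]

theorem solves_oddElect [Fintype V] (hodd : Odd T.diam) (h3 : 3 ≤ T.diam) {a : OddAdvice}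
    (ha : T.IsOddAdvice a) : T.Solves (OddElect a.encode) (T.diam - 2) := by
  obtain ⟨c, c', s, hc, hd, hsep, hs, -, hk, hm, hp⟩ := ha
  obtain ⟨h, hh⟩ := hodd
  have h0 : 0 < h := by omega
  have H := hc.isCenter hh
  have hout : ∀ v, T.Outputs (OddElect a.encode) (T.diam - 2) v
      (oddElectOutput a (T.view v (T.diam - 2))) := fun v => by
    refine ⟨T.diam - 2, le_rfl, ?_, fun r hr => ?_⟩
    · rw [OddElect, OddAdvice.decode_encode, hd, if_pos rfl]
    · rw [OddElect, OddAdvice.decode_encode, hd, if_neg hr.ne]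
  refine ⟨c, fun v => ⟨_, hout v, ?_⟩⟩
  rcases near_or H.adj v with hv | hv
  · rw [H.oddElectOutput_eq h0 hv hd hsep, if_pos ⟨s, hs, hm⟩, outgoing_seq]
    exact ⟨_, T.path_isPath v c, rfl⟩
  -- If the `j`-th sequence on this side also had `m` at position `k`, the common prefix could be
  -- extended, against the maximality of `k`.
  · have hno : ¬ ∃ t, (T.candList c' c)[a.j]? = some t ∧ t[a.k]? = some a.m := by
      rintro ⟨t, ht, htm⟩
      have hget : (T.candList c' c).getD a.j [] = t := by
        rw [List.getD_eq_getElem?_getD, ht]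
        rfl
      rw [hget] at hk
      obtain ⟨h4, h5⟩ := List.getElem?_eq_some_iff.1 hm
      obtain ⟨h6, h7⟩ := List.getElem?_eq_some_iff.1 htm
      have h8 := hk.2 (show a.k + 1 ∈ _ from ⟨h4, h6, by
        rw [List.take_add_one, List.take_add_one, hm, htm, hk.1.2.2]⟩)
      omega
    rw [H.symm.oddElectOutput_eq h0 hv hd (hsep.trans separated_symm), if_neg hno, outgoing_seq,
      hp]
    refine ⟨_, T.path_isPath v c, ?_⟩
    rw [(hv.between_left H.adj.symm (near_self H.adj)).path_eq, path_adj H.adj.symm]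
    simp [outPorts]

end PortTree

/-! ### Length of the encoded advice -/

theorem length_encodeNat (n : ℕ) : (encodeNat n).length = 2 * n.size + 1 := by
  simp [encodeNat, List.length_flatMap, Nat.size_eq_bits_len, mul_comm]

theorem Nat.size_le_of_lt_mul_self {x n : ℕ} (h : x < n * n) : x.size ≤ 2 * n.size := by
  rw [Nat.size_le, two_mul, pow_add]
  exact h.trans (Nat.mul_lt_mul'' n.lt_size_self n.lt_size_self)

/-- Five numbers of at most `2 * n.size` binary digits, each digit doubled, give `6 + 20 * n.size`
bits. Since `n.size - 1` is at most the binary logarithm of `n`, and `4 ≤ n` lets `log n` absorb the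
constants, 100 is ample. -/
theorem OddAdvice.length_encode_le {a : OddAdvice} {n : ℕ} (hn : 4 ≤ n) (hd : a.diam < n * n)
    (hj : a.j < n * n) (hk : a.k < n * n) (hm : a.m < n * n) (hp : a.p < n * n) :
    (a.encode.length : ℝ) ≤ 100 * Real.log n := by
  have h1 : a.encode.length ≤ 6 + 20 * n.size := by
    have := Nat.size_le_of_lt_mul_self hd
    have := Nat.size_le_of_lt_mul_self hj
    have := Nat.size_le_of_lt_mul_self hk
    have := Nat.size_le_of_lt_mul_self hm
    have := Nat.size_le_of_lt_mul_self hp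
    simp only [OddAdvice.encode, List.length_cons, List.length_append, length_encodeNat]
    omega
  have hpos : 0 < n.size := Nat.size_pos.2 (by omega)
  have h2 : 2 ^ (n.size - 1) ≤ n := Nat.lt_size.1 (by omega)
  have h3 : ((n.size - 1 : ℕ) : ℝ) * Real.log 2 ≤ Real.log n := by
    rw [← Real.log_pow]
    exact Real.log_le_log (by positivity) (by exact_mod_cast h2)
  have hl2 := Real.log_two_gt_d9
  have h4 : 2 * Real.log 2 ≤ Real.log n := by
    have : Real.log ((2 : ℝ) ^ 2) ≤ Real.log n :=
      Real.log_le_log (by norm_num) (by norm_num; exact_mod_cast hn)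
    rwa [Real.log_pow] at this
  have h5 : ((n.size - 1 : ℕ) : ℝ) * (1 / 2) ≤ ((n.size - 1 : ℕ) : ℝ) * Real.log 2 :=
    mul_le_mul_of_nonneg_left (by linarith) (by positivity)
  have h6 : (a.encode.length : ℝ) ≤ 6 + 20 * (((n.size - 1 : ℕ) : ℝ) + 1) := by
    have : a.encode.length ≤ 6 + 20 * ((n.size - 1) + 1) := by omega
    exact_mod_cast this
  linarith

namespace PortTree

variable {V : Type u} {T : PortTree V}

/-! ### The size of the advice -/

theorem dist_lt_card [Fintype V] (x y : V) : T.graph.dist x y < Fintype.card V := by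
  rw [← length_path]
  exact (T.path_isPath x y).length_lt

theorem diam_lt_card [Fintype V] (T : PortTree V) : T.diam < Fintype.card V := by
  obtain ⟨x, y, h⟩ := T.exists_dist_eq_diam
  exact h ▸ T.dist_lt_card x y

theorem port_lt_card [Fintype V] {x y : V} (h : T.graph.Adj x y) : T.port x y < Fintype.card V := by
  refine (port_lt h).trans_le ?_
  rw [degree, ← Nat.card_eq_fintype_card, ← Set.ncard_univ]
  exact Set.ncard_le_ncard (Set.subset_univ _)

theorem lt_card_of_mem_seq [Fintype V] {x y : V} {q : ℕ} (h : q ∈ T.seq x y) :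
    q < Fintype.card V := by
  obtain ⟨d, -, hd⟩ := List.mem_flatMap.1 h
  simp only [List.mem_cons, List.not_mem_nil, or_false] at hd
  rcases hd with rfl | rfl
  · exact port_lt_card d.adj
  · exact port_lt_card d.adj.symm

theorem exists_prefix_of_mem_candList [Fintype V] {c c' : V} (h : T.graph.Adj c c') {s : List ℕ}
    (hs : s ∈ T.candList c c') : ∃ y, s <+: T.seq c y := by
  unfold candList at hs
  split_ifs at hs
  · obtain ⟨y, -, rfl⟩ := (mem_sepList h).1 hs
    exact ⟨y, List.prefix_rfl⟩
  · exact (mem_shortList.1 hs).2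

theorem length_candList_le [Fintype V] (c c' : V) :
    (T.candList c c').length ≤ Fintype.card V * Fintype.card V := by
  have hpos : 0 < Fintype.card V := Fintype.card_pos_iff.2 ⟨c⟩
  unfold candList
  split_ifs
  · rw [sepList, Finset.length_sort]
    refine (Finset.card_image_le.trans (Finset.card_le_univ _)).trans
      (Nat.le_mul_of_pos_left _ hpos)
  · rw [shortList, Finset.length_sort]
    refine Finset.card_image_le.trans ?_
    rw [Finset.card_product, Finset.card_univ, Finset.card_range]
    refine Nat.mul_le_mul_left _ ?_
    have := T.diam_lt_card
    omega

theorem IsOddAdvice.length_encode_le [Fintype V] (h3 : 3 ≤ T.diam) {a : OddAdvice}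
    (ha : T.IsOddAdvice a) : (a.encode.length : ℝ) ≤ 100 * Real.log (Fintype.card V) := by
  obtain ⟨c, c', s, hc, hd, -, hs, -, -, hm, hp⟩ := ha
  have hn := T.diam_lt_card
  obtain ⟨hj, hjs⟩ := List.getElem?_eq_some_iff.1 hs
  obtain ⟨y, hy⟩ := exists_prefix_of_mem_candList hc.1 (hjs ▸ List.getElem_mem hj)
  obtain ⟨hk, hkm⟩ := List.getElem?_eq_some_iff.1 hm
  have hlen := hy.length_le
  rw [length_seq] at hlen
  have hdist := T.dist_lt_card c y
  have hmn := lt_card_of_mem_seq (hy.subset (hkm ▸ List.getElem_mem hk))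
  have hpn := hp ▸ port_lt_card hc.1.symm
  -- The index `k` is below `2n`, the other entries except `j` are below `n`; for `n ≥ 4` all are
  -- below `n * n`.
  have hsq : 4 * Fintype.card V ≤ Fintype.card V * Fintype.card V :=
    Nat.mul_le_mul_right _ (by omega)
  exact OddAdvice.length_encode_le (by omega) (by omega)
    (hj.trans_le (length_candList_le c c')) (by omega) (by omega) (by omega)

/-! ### The path with four nodes -/

open Classical in
/-- Leader election on the path with four nodes whose central edge has ports `0` and `1`. -/
noncomputable def _root_.pathElect : LocalAlgorithm := fun r W =>
  if r = 1 then
    some (if ([], 1) ∈ W then if ([0, 1], 2) ∈ W then [0] else [0, 1]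
      else if ([1, 0], 2) ∈ W then [1] else [])
  else none

theorem adj_of_seq_eq_pair {x y : V} {q r : ℕ} (h : T.seq x y = [q, r]) :
    T.graph.Adj x y ∧ T.port x y = q ∧ T.port y x = r := by
  obtain ⟨h1, -, h2, h3⟩ := adj_of_seq_eq_append (c := x) (y := x) (z := y) (q := q) (r := r)
    (by simpa using h)
  exact ⟨h1, h2, h3⟩

theorem IsCenter.eq_or_leaf {c c' v : V} (H : T.IsCenter 1 c c') (hv : T.Near c c' v) :
    v = c ∨ T.graph.Adj c v ∧ T.degree v = 1 ∧ T.port v c = 0 ∧ T.port c v ≠ T.port c c' := by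
  rcases Nat.le_one_iff_eq_zero_or_eq_one.1 (H.depth v hv) with h | h
  · rw [T.dist_eq_zero] at h
    exact Or.inl h.symm
  · have hadj := SimpleGraph.dist_eq_one_iff_adj.1 h
    have hd := H.degree_eq_one one_pos hv h
    refine Or.inr ⟨hadj, hd, port_eq_zero_of_leaf hd hadj.symm, fun hp => ?_⟩
    rw [port_inj hadj H.adj hp] at hv
    exact hv.not_near (near_self H.adj.symm)

/-- For `h = 1` a side is a star with port 0 at every leaf, so it is determined by the degree of its
centre and the port of the central edge. -/
theorem IsCenter.exists_seq_eq_of_port_eq {c c' y : V} (H : T.IsCenter 1 c c')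
    (hd : T.degree c = T.degree c') (hp : T.port c c' = T.port c' c) (hy : T.Near c c' y) :
    ∃ y', T.Near c' c y' ∧ T.seq c' y' = T.seq c y := by
  rcases H.eq_or_leaf hy with rfl | ⟨hadj, -, h1, h2⟩
  · exact ⟨c', near_self H.adj.symm, by simp⟩
  · obtain ⟨z, hz, hzp⟩ := exists_port (T := T) (hd ▸ port_lt hadj)
    have hzn : T.Near c' c z := near_of_adj H.adj.symm hz (by
      rintro rfl
      exact h2 (hzp.symm.trans hp.symm))
    refine ⟨z, hzn, ?_⟩
    rcases H.symm.eq_or_leaf hzn with rfl | ⟨-, -, h3, -⟩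
    · exact absurd hz (SimpleGraph.irrefl _)
    · rw [seq_adj hz, seq_adj hadj, hzp, h1, h3]

theorem nil_mem_view [Fintype V] {v : V} {r d : ℕ} : ([], d) ∈ T.view v r ↔ T.degree v = d := by
  rw [mem_view]
  constructor
  · rintro ⟨y, -, hy⟩
    rw [Prod.mk.injEq] at hy
    rw [seq_injective v ((seq_self v).trans hy.1.symm), hy.2]
  · rintro rfl
    exact ⟨v, by simp, by simp⟩

/-- The elected end is the one with central port 0. Both inner nodes see a neighbour at address `[1,
0]`; for `c` it is a leaf, for `c'` it is `c`, so the degree decides. -/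
theorem IsCenter.solves_pathElect [Fintype V] {c c' : V} (H : T.IsCenter 1 c c')
    (hd : T.degree c = 2) (hd' : T.degree c' = 2) (hp : T.port c c' = 0) (hp' : T.port c' c = 1) :
    T.Solves pathElect 1 := by
  refine ⟨c, fun v => ⟨outgoing (T.seq v c), ⟨1, le_rfl, ?_, fun r hr => ?_⟩,
    T.path v c, T.path_isPath v c, (outgoing_seq v c).symm⟩⟩
  · rw [pathElect, if_pos rfl]
    congr 1
    rcases near_or H.adj v with hv | hv
    · rcases H.eq_or_leaf hv with rfl | ⟨hadj, h1, h2, h3⟩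
      · rw [if_neg (by rw [nil_mem_view]; omega), if_neg, seq_self]
        · rfl
        · intro hm
          obtain ⟨y, -, hy⟩ := mem_view.1 hm
          rw [Prod.mk.injEq] at hy
          obtain ⟨h1, h2, -⟩ := adj_of_seq_eq_pair hy.1
          have hyn := near_of_adj H.adj h1 (by
            rintro rfl
            omega)
          have := H.degree_eq_one one_pos hyn (dist_of_adj h1)
          omega
      · have h4 : T.port c v = 1 := by
          have := port_lt hadj
          omega
        have h5 : T.seq v c = [0, 1] := by rw [seq_adj hadj.symm, h2, h4]
        rw [if_pos (nil_mem_view.2 h1), if_pos (mem_view.2 ⟨c, (dist_of_adj hadj.symm).le, by rw [h5, hd]⟩), h5]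
        rfl
    · rcases H.symm.eq_or_leaf hv with rfl | ⟨hadj, h1, h2, h3⟩
      · have h5 : T.seq v c = [1, 0] := by rw [seq_adj H.adj.symm, hp, hp']
        rw [if_neg (by rw [nil_mem_view]; omega),
          if_pos (mem_view.2 ⟨c, (dist_of_adj H.adj.symm).le, by rw [h5, hd]⟩), h5]
        rfl
      · have h4 : T.port c' v = 0 := by
          have := port_lt hadj
          omega
        have h5 : T.seq v c = [0, 0, 1, 0] := by
          rw [(hv.between_left H.adj.symm (near_self H.adj)).seq_eq, seq_adj hadj.symm,
            seq_adj H.adj.symm, h2, h4, hp, hp']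
          rfl
        rw [if_pos (nil_mem_view.2 h1), if_neg, h5]
        · rfl
        · intro hm
          obtain ⟨y, -, hy⟩ := mem_view.1 hm
          rw [Prod.mk.injEq] at hy
          obtain ⟨h6, h7, h8⟩ := adj_of_seq_eq_pair hy.1
          obtain rfl := port_inj h6 hadj.symm (by omega)
          omega
  · rw [pathElect, if_neg (by omega)]

theorem solves_pathElect_of_card [Fintype V] (hodd : Odd T.diam)
    (hxi : T.xi + 2 ≤ (T.diam : ℕ∞)) (hcard : Fintype.card V = 4) :
    T.Solves pathElect (T.diam - 2) := by
  obtain ⟨τ, hτ, alg, hs⟩ := exists_solves_of_xi hxi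
  have hlt := T.diam_lt_card
  obtain ⟨h, hh⟩ := hodd
  obtain rfl : h = 1 := by omega
  obtain ⟨c, c', H⟩ := exists_isCenter hh
  have h1 := H.card_eq
  have h2 := H.two_le_degree one_pos
  have h3 := H.symm.two_le_degree one_pos
  have hd : T.degree c = 2 := by omega
  have hd' : T.degree c' = 2 := by omega
  -- Equal ports on the central edge would make the path symmetric under reversal, and no election
  -- would be possible.
  have hne : T.port c c' ≠ T.port c' c := fun hp =>
    not_solves_of_seq_eq H.adj
      (fun y hy => H.exists_seq_eq_of_port_eq (hd.trans hd'.symm) hp hy)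
      (fun y hy => H.symm.exists_seq_eq_of_port_eq (hd'.trans hd.symm) hp.symm hy) hs
  have h4 := port_lt H.adj
  have h5 := port_lt H.adj.symm
  rw [hh]
  rcases (show T.port c c' = 0 ∧ T.port c' c = 1 ∨ T.port c' c = 0 ∧ T.port c c' = 1 by omega) with
    h6 | h6
  · exact H.solves_pathElect hd hd' h6.1 h6.2
  · exact H.symm.solves_pathElect hd' hd h6.1 h6.2

theorem three_le_diam [Fintype V] (hodd : Odd T.diam) (hxi : T.xi + 2 ≤ (T.diam : ℕ∞)) :
    3 ≤ T.diam := by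
  obtain ⟨τ, hτ, -⟩ := exists_solves_of_xi hxi
  obtain ⟨h, hh⟩ := hodd
  omega

end PortTree

/-! ### The two statements combined -/

/-- Leader election in time `D - 2` in trees of odd diameter `D` with `xi T ≤ D - 2`, with advice of
size `O(log n)`: algorithm OddElect does this for all such trees except the path with four nodes,
the only tree with four nodes and odd diameter (there the advice of OddElect may not exist); and
with the advice adapted to this one tree, it is possible for all such trees without exception. -/
theorem theorem3 :
    ∃ C : ℝ,
      (∀ (V : Type u) [Fintype V] (T : PortTree V),
        Odd T.diam → T.xi + 2 ≤ (T.diam : ℕ∞) → Fintype.card V ≠ 4 →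
          (∃ a : OddAdvice, T.IsOddAdvice a) ∧
          ∀ a : OddAdvice, T.IsOddAdvice a →
            (a.encode.length : ℝ) ≤ C * Real.log (Fintype.card V) ∧
            T.Solves (OddElect a.encode) (T.diam - 2)) ∧
      (∃ alg : List Bool → LocalAlgorithm,
        ∀ (V : Type u) [Fintype V] (T : PortTree V),
          Odd T.diam → T.xi + 2 ≤ (T.diam : ℕ∞) →
            ∃ A : List Bool,
              (A.length : ℝ) ≤ C * Real.log (Fintype.card V) ∧
              T.Solves (alg A) (T.diam - 2)) := by
  refine ⟨100, fun V _ T hodd hxi hcard => ⟨PortTree.exists_isOddAdvice hodd hxi hcard,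
    fun a ha => ?_⟩, fun A => if A = [] then pathElect else OddElect A,
    fun V _ T hodd hxi => ?_⟩
  · have h3 := PortTree.three_le_diam hodd hxi
    exact ⟨ha.length_encode_le h3, PortTree.solves_oddElect hodd h3 ha⟩
  · have h3 := PortTree.three_le_diam hodd hxi
    by_cases hcard : Fintype.card V = 4
    -- The empty string can signal the four-node path, because an encoded advice always contains at
    -- least the separated bit.
    · refine ⟨[], ?_, ?_⟩
      · simpa using Real.log_natCast_nonneg (Fintype.card V)
      · beta_reduce
        rw [if_pos rfl]
        exact PortTree.solves_pathElect_of_card hodd hxi hcard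
    · obtain ⟨a, ha⟩ := PortTree.exists_isOddAdvice hodd hxi hcard
      refine ⟨a.encode, ha.length_encode_le h3, ?_⟩
      beta_reduce
      rw [if_neg (by simp [OddAdvice.encode])]
      exact PortTree.solves_oddElect hodd h3 ha
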